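/- Let $A=\mathbb F_q[T]$, $K=\mathbb F_q(T)$, let $K_\infty$ be the completion of $K$ at $\infty=1/T$ (with $|T|=q$), $\mathbb C_\infty$ the completion of an algebraic closure of $K_\infty$, $\Omega=\mathbb C_\infty\setminus K_\infty$, and let $\mathcal O$ be the set of rigid analytic functions $\Omega\to\mathbb C_\infty$ that are $I$-periodic for some nonzero ideal $I$ of $A$. For $\gamma=\begin{pmatrix}a&b\\c&d\end{pmatrix}\in \mathrm{GL}_2(K)$ put $(f|_{k,m}\gamma)(z)=(\det\gamma)^m(cz+d)^{-k}f(\gamma z)$. Let $\Gamma\subset\mathrm{GL}_2(K)$ be a subgroup that is commensurable with $\mathrm{GL}_2(A)$ and contains $\Gamma(\mathfrak m)=\ker(\mathrm{GL}_2(A)\to\mathrm{GL}_2(A/\mathfrak m))$ for some nonzero ideal $\mathfrak m$ of $A$. A rigid analytic $f:\Omega\to\mathbb C_\infty$ is a Drinfeld quasi-modular form of weight $k$, type $m$ and depth at most $\ell$ for $\Gamma$, written $f\in\widetilde M^{\leqslant\ell}_{k,m}(\Gamma)$, if there is a polynomial $P_f=\sum_{i=0}^{\ell}f_iX^i\in\mathcal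 O[X]$, called the associated polynomial of $f$, such that $$(f|_{k,m}\gamma)(z)=\sum_{i=0}^{\ell}f_i(z)\Bigl(\frac{c}{cz+d}\Bigr)^i\qquad\text{for all }\gamma\in\Gamma,\ z\in\Omega,$$ and such that, for all $i$ and all $\gamma\in\mathrm{GL}_2(K)$, $|(f_i|_{k-2i,m-i}\gamma)(z)|$ is bounded as $\inf_{x\in K_\infty}|z-x|\to\infty$. Let $M_{k,m}(\Gamma)=\widetilde M^{\leqslant 0}_{k,m}(\Gamma)$ be the space of Drinfeld modular forms. Let $\tilde\pi$ be a period of the Carlitz module (a generator of the $A$-module of zeros of the Carlitz exponential), let $$E(z)=\tilde\pi^{-1}\sum_{a\in A\text{ monic}}\ \sum_{b\in A}\frac{a}{az+b}$$ be the false Eisenstein series, and let $D_n=(-\tilde\pi)^{-n}\mathcal D_n$, where the hyperderivatives $\mathcal D_n$ are defined by $f(z+\varepsilon)=\sum_{n\ge0}(\mathcal D_nf)(z)\varepsilon^n$ for small $\varepsilon$. **Theorem.** Let $\ell\ge1$ and $f\in\widetilde M^{\leqslant\ell}_{k,m}(\Gamma)$. (1) If $k>2\ell$ and $f=\sum_{i=0}^{\ell}D_if_{i,D}$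 with $f_{i,D}\in M_{k-2i,m-i}(\Gamma)$ for $0\le i\le\ell$, then the associated polynomial of $f$ is (uniquely) $P_f=\sum_{j=0}^{\ell}f_jX^j$ with $$f_j=(-\tilde\pi)^{-j}\sum_{h=j}^{\ell}\binom{k-h-1}{j}D_{h-j}f_{h,D}\qquad(0\le j\le\ell).$$ (2) If $k=2\ell$ and $f=\alpha_fD_{\ell-1}E+\sum_{i=0}^{\ell-1}D_if_{i,D}$ with $\alpha_f\in\mathbb C_\infty$ and $f_{i,D}\in M_{k-2i,m-i}(\Gamma)$ for $0\le i\le\ell-1$, then the associated polynomial of $f$ is (uniquely) $P_f=\sum_{j=0}^{\ell}f_jX^j$ with $f_\ell=\alpha_f(-\tilde\pi)^{-\ell}$ and $$f_j=(-\tilde\pi)^{-j}\Bigl[\alpha_f\binom{\ell}{j}D_{\ell-j-1}E+\sum_{h=j}^{\ell-1}\binom{2\ell-h-1}{j}D_{h-j}f_{h,D}\Bigr]\qquad(0\le j\le\ell-1).$$ -/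

import Mathlib

open Filter Topology Polynomial
open scoped NNReal

noncomputable section

namespace Drinfeld

/-! ### The fields `A ⊆ K ⊆ K_∞ ⊆ ℂ_∞` -/

section Fields

variable (F : Type*) [Field F]

/-- `A = 𝔽_q[T]`, for the finite field `F = 𝔽_q`. -/
abbrev A := Polynomial F

/-- `K = 𝔽_q(T)`. -/
abbrev K := RatFunc F

open scoped Classical in
/-- `K_∞`, the completion of `K` at the place `∞ = 1/T`. -/
abbrev KInf := RatFunc.CompletionAtInfty F

variable [Finite F]

theorem one_lt_card : (1 : ℝ≥0) < (Nat.card F : ℝ≥0) := by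
  exact_mod_cast Finite.one_lt_card

/-- The valuation on `K_∞` is normalised so that `|T|_∞ = q`. -/
instance rankOneKInf : (Valued.v : Valuation (KInf F) (WithZero (Multiplicative ℤ))).RankOne where
  hom' := (WithZeroMulInt.toNNReal (one_lt_card F).ne_zero).comp
    MonoidWithZeroHom.ValueGroup₀.embedding
  strictMono' := (WithZeroMulInt.toNNReal_strictMono (one_lt_card F)).comp
    MonoidWithZeroHom.ValueGroup₀.embedding_strictMono
  exists_val_nontrivial := by
    classical
    refine ⟨algebraMap (RatFunc F) (KInf F) RatFunc.X, ?_⟩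
    have h : Valued.v (algebraMap (RatFunc F) (KInf F) RatFunc.X) =
        WithZero.exp (1 : ℤ) := by
      let _ := RatFunc.inftyValued F
      exact (RatFunc.valuedCompletionAtInfty.def F).trans
        ((Valued.extensionValuation_apply_coe (K := RatFunc F) RatFunc.X).trans
          (RatFunc.inftyValuation.X F))
    rw [h]
    exact ⟨WithZero.exp_ne_zero, by simp [← WithZero.exp_zero]⟩

/-- The `∞`-adic absolute value on `K_∞`. -/
instance : NontriviallyNormedField (KInf F) :=
  Valued.toNontriviallyNormedField (KInf F) (WithZero (Multiplicative ℤ))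

instance : IsUltrametricDist (KInf F) := by
  infer_instance

instance : CompleteSpace (KInf F) := by
  classical
  let _ := RatFunc.inftyValued F
  exact inferInstanceAs (CompleteSpace (UniformSpace.Completion (RatFunc F)))

/-- An algebraic closure of `K_∞`, with the unique extension of the absolute value. -/
abbrev KInfAlg := AlgebraicClosure (KInf F)

instance : NontriviallyNormedField (KInfAlg F) :=
  spectralNorm.nontriviallyNormedField (KInf F) (KInfAlg F)

instance : NormedAlgebra (KInf F) (KInfAlg F) := spectralNorm.normedAlgebra _ _

/-- `ℂ_∞`, the completion of an algebraic closure of `K_∞`. -/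
abbrev CInf := UniformSpace.Completion (KInfAlg F)

/-- The absolute value of `ℂ_∞`, extending that of `K_∞`. -/
instance : NontriviallyNormedField (CInf F) where
  toNormedField := inferInstance
  non_trivial := by
    obtain ⟨x, hx⟩ := NontriviallyNormedField.non_trivial (α := KInf F)
    exact ⟨algebraMap (KInf F) (CInf F) x, by simpa using hx⟩

end Fields

variable {F : Type*} [Field F] [Finite F]

/-- The embedding `K → ℂ_∞`. -/
def ofK : K F →+* CInf F :=
  (algebraMap (KInf F) (CInf F)).comp (algebraMap (K F) (KInf F))

/-- The embedding `A → ℂ_∞`. -/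
def ofA : A F →+* CInf F := ofK.comp (algebraMap (A F) (K F))

/-! ### The Drinfeld upper half-plane and the action of `GL₂(K)` -/

variable (F) in
/-- The Drinfeld upper half-plane `Ω = ℙ¹(ℂ_∞) - ℙ¹(K_∞) = ℂ_∞ - K_∞`. -/
abbrev Omega := {z : CInf F // z ∉ Set.range (algebraMap (KInf F) (CInf F))}

/-- `cz + d` for `γ = (a b; c d)`. -/
def den (γ : GL (Fin 2) (K F)) (z : Omega F) : CInf F := ofK (γ 1 0) * z + ofK (γ 1 1)

/-- `az + b` for `γ = (a b; c d)`. -/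
def num (γ : GL (Fin 2) (K F)) (z : Omega F) : CInf F := ofK (γ 0 0) * z + ofK (γ 0 1)

theorem eq_zero_of_mul_add_eq_zero {u v : KInf F} (z : Omega F)
    (h : algebraMap (KInf F) (CInf F) u * z + algebraMap (KInf F) (CInf F) v = 0) :
    u = 0 ∧ v = 0 := by
  have hu : u = 0 := by
    by_contra hu
    have hu' : algebraMap (KInf F) (CInf F) u ≠ 0 := by simpa using hu
    refine z.2 ⟨-v / u, ?_⟩
    rw [map_div₀, map_neg]
    field_simp
    linear_combination -h
  subst hu
  simpa using h

theorem det_ne_zero {F : Type*} [Field F] (γ : GL (Fin 2) (K F)) :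
    γ 0 0 * γ 1 1 - γ 0 1 * γ 1 0 ≠ 0 := by
  have h := γ.det.ne_zero
  rwa [Matrix.GeneralLinearGroup.val_det_apply, Matrix.det_fin_two] at h

theorem den_ne_zero (γ : GL (Fin 2) (K F)) (z : Omega F) : den γ z ≠ 0 := by
  intro h
  obtain ⟨hc, hd⟩ := eq_zero_of_mul_add_eq_zero z h
  have hc' : γ 1 0 = 0 := by simpa using hc
  have hd' : γ 1 1 = 0 := by simpa using hd
  exact det_ne_zero γ (by simp [hc', hd'])

theorem num_div_den_mem (γ : GL (Fin 2) (K F)) (z : Omega F) :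
    num γ z / den γ z ∉ Set.range (algebraMap (KInf F) (CInf F)) := by
  rintro ⟨x, hx⟩
  rw [eq_div_iff (den_ne_zero γ z)] at hx
  have h : algebraMap (KInf F) (CInf F)
        (algebraMap (K F) (KInf F) (γ 0 0) - x * algebraMap (K F) (KInf F) (γ 1 0)) * z +
      algebraMap (KInf F) (CInf F)
        (algebraMap (K F) (KInf F) (γ 0 1) - x * algebraMap (K F) (KInf F) (γ 1 1)) = 0 := by
    simp only [num, den, ofK, RingHom.comp_apply] at hx
    simp only [map_sub, map_mul]
    linear_combination -hx
  obtain ⟨h1, h2⟩ := eq_zero_of_mul_add_eq_zero z h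
  apply det_ne_zero γ
  apply (algebraMap (K F) (KInf F)).injective
  simp only [map_sub, map_mul, map_zero]
  linear_combination (algebraMap (K F) (KInf F) (γ 1 1)) * h1 -
    (algebraMap (K F) (KInf F) (γ 1 0)) * h2

/-- The fractional linear transformation `γ z = (az + b) / (cz + d)` of `Ω`. -/
def moebius (γ : GL (Fin 2) (K F)) (z : Omega F) : Omega F :=
  ⟨num γ z / den γ z, num_div_den_mem γ z⟩

/-- The slash operator `(f |_{k,m} γ)(z) = (det γ)^m (cz + d)^{-k} f(γ z)`. -/
def slash (k m : ℤ) (f : Omega F → CInf F) (γ : GL (Fin 2) (K F)) : Omega F → CInf F :=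
  fun z => ofK (γ.det : K F) ^ m * den γ z ^ (-k) * f (moebius γ z)

/-! ### Arithmetic subgroups of congruence type -/

variable (F) in
/-- `GL₂(A)`, as a subgroup of `GL₂(K)`. -/
def GL2A : Subgroup (GL (Fin 2) (K F)) :=
  (Matrix.GeneralLinearGroup.map (algebraMap (A F) (K F))).range

/-- `Γ(𝔪)`, the matrices in `GL₂(A)` congruent to the identity modulo `𝔪`,
as a subgroup of `GL₂(K)`. -/
def principal (𝔪 : Ideal (A F)) : Subgroup (GL (Fin 2) (K F)) :=
  (Matrix.GeneralLinearGroup.map (n := Fin 2) (Ideal.Quotient.mk 𝔪)).ker.map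
    (Matrix.GeneralLinearGroup.map (algebraMap (A F) (K F)))

/-- `Γ` is an arithmetic subgroup of congruence type: it is commensurable with `GL₂(A)` and
contains `Γ(𝔪)` for some nonzero ideal `𝔪` of `A`. -/
def IsCongruence (Γ : Subgroup (GL (Fin 2) (K F))) : Prop :=
  Γ.Commensurable (GL2A F) ∧ ∃ 𝔪 : Ideal (A F), 𝔪 ≠ ⊥ ∧ principal 𝔪 ≤ Γ

/-! ### Rigid analytic functions -/

variable (F) in
/-- The standard affinoid
`Ω_n = {z : |z| ≤ q^n and |z - x| ≥ q^{-n} for all x ∈ K_∞}`. The `Ω_n` for `n ∈ ℕ` form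
an admissible covering of `Ω`. -/
def affinoid (n : ℕ) : Set (Omega F) :=
  {z | ‖(z : CInf F)‖ ≤ (Nat.card F : ℝ) ^ n ∧
    ∀ x : KInf F, ((Nat.card F : ℝ) ^ n)⁻¹ ≤ ‖(z : CInf F) - algebraMap (KInf F) (CInf F) x‖}

/-- `f` is rigid analytic on `Ω`: on each affinoid `Ω_n` it is a uniform limit of rational
functions without poles on `Ω_n`. -/
def IsRigidAnalytic (f : Omega F → CInf F) : Prop :=
  ∀ n : ℕ, ∀ ε : ℝ, 0 < ε → ∃ P Q : (CInf F)[X], ∀ z ∈ affinoid F n,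
    Q.eval (z : CInf F) ≠ 0 ∧ ‖f z - P.eval (z : CInf F) / Q.eval (z : CInf F)‖ ≤ ε

/-- The set `𝒪` of rigid analytic functions on `Ω` that are `I`-periodic for some nonzero
ideal `I` of `A`. -/
def MemO (f : Omega F → CInf F) : Prop :=
  IsRigidAnalytic f ∧ ∃ I : Ideal (A F), I ≠ ⊥ ∧
    ∀ a ∈ I, ∀ z w : Omega F, (w : CInf F) = z + ofA a → f w = f z

/-! ### Quasi-modular forms and associated polynomials -/

/-- `P = ∑ f_i X^i ∈ 𝒪[X]` is the associated polynomial of `f` (in weight `k` and type `m`,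
for `Γ`): for all `γ = (a b; c d) ∈ Γ` and all `z`,
`(f |_{k,m} γ)(z) = ∑ f_i(z) (c / (cz + d))^i`. -/
def IsAssocPoly (Γ : Subgroup (GL (Fin 2) (K F))) (k m : ℤ) (f : Omega F → CInf F)
    (P : (Omega F → CInf F)[X]) : Prop :=
  (∀ i, MemO (P.coeff i)) ∧
  ∀ γ ∈ Γ, ∀ z : Omega F, slash k m f γ z =
    ∑ i ∈ Finset.range (P.natDegree + 1), P.coeff i z * (ofK (γ 1 0) / den γ z) ^ i

/-- The imaginary absolute value `|z|_i = inf {|z - x| : x ∈ K_∞}`. -/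
def imAbs (z : Omega F) : ℝ :=
  ⨅ x : KInf F, ‖(z : CInf F) - algebraMap (KInf F) (CInf F) x‖

/-- `f` is bounded on vertical lines: `|f(z)|` is bounded as `|z|_i → ∞`. -/
def BoundedOnVerticalLines (f : Omega F → CInf F) : Prop :=
  ∃ N B : ℝ, ∀ z : Omega F, N ≤ imAbs z → ‖f z‖ ≤ B

/-- `f` is a Drinfeld quasi-modular form of weight `k`, type `m` and depth at most `ℓ`
for `Γ`. -/
def IsQuasiModularForm (Γ : Subgroup (GL (Fin 2) (K F))) (k m : ℤ) (ℓ : ℕ)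
    (f : Omega F → CInf F) : Prop :=
  IsRigidAnalytic f ∧ ∃ P : (Omega F → CInf F)[X], P.natDegree ≤ ℓ ∧ IsAssocPoly Γ k m f P ∧
    ∀ (i : ℕ) (γ : GL (Fin 2) (K F)),
      BoundedOnVerticalLines (slash (k - 2 * i) (m - i) (P.coeff i) γ)

/-- `f` is a Drinfeld modular form of weight `k` and type `m` for `Γ`. -/
def IsModularForm (Γ : Subgroup (GL (Fin 2) (K F))) (k m : ℤ) (f : Omega F → CInf F) : Prop :=
  IsQuasiModularForm Γ k m 0 f

/-! ### Hyperderivatives -/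

open scoped Classical in
/-- The hyperderivative `𝒟_n f`, determined by `f(z + ε) = ∑ (𝒟_n f)(z) ε^n` for all small `ε`.
(At points where `f` has no such expansion, which do not exist for rigid analytic `f`, the value
is `0`.) -/
def hyperDeriv (n : ℕ) (f : Omega F → CInf F) (z : Omega F) : CInf F :=
  if h : ∃ a : ℕ → CInf F, ∀ᶠ ε in 𝓝 (0 : CInf F),
      ∃ hε : (z : CInf F) + ε ∉ Set.range (algebraMap (KInf F) (CInf F)),
        HasSum (fun i => a i * ε ^ i) (f ⟨z + ε, hε⟩)
  then h.choose n else 0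

/-- The normalised hyperderivative `D_n = (-π̃)^{-n} 𝒟_n`. -/
def normDeriv (π : CInf F) (n : ℕ) (f : Omega F → CInf F) : Omega F → CInf F :=
  ((-π) ^ n)⁻¹ • hyperDeriv n f

/-! ### The Carlitz period and the false Eisenstein series -/

variable (F) in
/-- `D_i = ∏_{j < i} (T^{q^i} - T^{q^j})`. -/
def carlitzD (i : ℕ) : A F :=
  ∏ j ∈ Finset.range i, (X ^ Nat.card F ^ i - X ^ Nat.card F ^ j)

/-- The exponential function `z ↦ ∑ z^{q^i} / D_i` of the Carlitz module. -/
def carlitzExp (z : CInf F) : CInf F :=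
  ∑' i : ℕ, z ^ Nat.card F ^ i / ofA (carlitzD F i)

/-- `π` is a period `π̃` of the Carlitz module: a generator of the `A`-lattice of zeros of the
Carlitz exponential. -/
def IsCarlitzPeriod (π : CInf F) : Prop :=
  π ≠ 0 ∧ ∀ z : CInf F, carlitzExp z = 0 ↔ ∃ a : A F, z = ofA a * π

/-- The false Eisenstein series `E(z) = π̃⁻¹ ∑_{a monic} ∑_b a / (az + b)`. -/
def falseE (π : CInf F) (z : Omega F) : CInf F :=
  π⁻¹ * ∑' a : {a : A F // a.Monic}, ∑' b : A F, ofA a.1 / (ofA a.1 * z + ofA b)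

end Drinfeld

end

/-! The group contains (1 0; c 1) for every c in some nonzero ideal 𝔪. For fixed z the numbers
c/(cz+1) are pairwise distinct, so these matrices alone determine an associated polynomial
(`eq_of_eval₂_eq`). Since f is assumed quasi-modular, some associated polynomial exists; it
therefore suffices to expand f|γ in powers of c/(cz+1) for these γ (`isAssocPoly_iff_eq`), without
checking the growth or periodicity of the coefficients.

Put J = cz+1 and u = cJη. The point z/J + η is the image under γ of w = z + J²η/(1-u), and cw+1 =
J/(1-u). Substituting this into g(γw) = (cw+1)^N g(w) and expanding the powers of (1-u)⁻¹ gives the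
Taylor coefficients of g at γz, with binomials C(N+h-1, j) (`HasExpansion.of_transformation`). For N
= k-2h these are C(k-h-1, j). For E, of weight 2, the defect -π̃⁻¹c(cw+1) expands as a geometric
series and adds one term in (c/J)^(h+1); for h = ℓ-1 it is the coefficient of X^ℓ.

Two analytic inputs remain. Rigid analytic functions must have local power series expansions: this
follows from the rational case and a nonarchimedean Cauchy estimate (`SumsOnBall.of_uniform_limit`).
The transformation law of E must be proved from its conditionally convergent series: grouping b
modulo constants gives an unconditionally convergent series, and summing over finite windows stable
under a ↦ a+cb reduces the law to a finite identity in which sums of q equal terms vanish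
(`sum_eisTerm_transform`). -/

noncomputable section

namespace Drinfeld

/-! ### Algebraic closedness of ℂ_∞. -/

/-- The completion of an algebraically closed nonarchimedean field, in any characteristic, is
algebraically closed. -/
theorem isAlgClosed_of_denseRange {K L : Type*} [Field K] [NontriviallyNormedField L]
    [CompleteSpace L] [IsUltrametricDist L] [Algebra K L]
    (hi : DenseRange (algebraMap K L)) [IsAlgClosed K] : IsAlgClosed L := by
  apply IsAlgClosed.of_exists_root
  intro f fmon firr
  have hdeg : f.natDegree ≠ 0 := (Irreducible.natDegree_pos firr).ne'
  let F := f.SplittingField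
  let : NormedField F := spectralNorm.normedField L F
  let : NormedAlgebra L F := spectralNorm.normedAlgebra L F
  let a := rootOfSplits (SplittingField.splits f)
      (by simpa using degree_ne_of_natDegree_ne hdeg)
  have fa0 : f.aeval a = 0 := by
    rw [← eval_map_algebraMap]
    exact eval_rootOfSplits (Polynomial.SplittingField.splits f)
      (by simpa using degree_ne_of_natDegree_ne hdeg)
  have happrox : ∀ δ > 0, ∃ b : L, ‖a - algebraMap L F b‖ < δ := by
    intro δ hδ
    -- This tolerance is the one for which continuity of roots puts a root of the approximating
    -- polynomial within δ of a.
    have hε : (δ / (max ‖a‖ 1)) ^ f.natDegree / (f.natDegree + 1) > 0 := by positivity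
    obtain ⟨g, gmon, gdeg, gcoeff⟩ :=
      exists_monic_and_natDegree_eq_and_norm_map_algebraMap_coeff_sub_lt hi fmon hε
    let ⟨b, hb, hab⟩ := exists_aroots_norm_sub_lt_of_norm_coeff_sub_lt
        hε fa0 fmon (gmon.map _) (gdeg ▸ (g.natDegree_map _)) gcoeff
        (by simpa [Polynomial.map_map] using (IsAlgClosed.splits g).map ((algebraMap L F).comp _))
    have hab : ‖a - b‖ < δ := by
      rw [← Real.rpow_natCast, ← mul_comm_div, div_self, one_mul,
          ← Real.rpow_mul (div_pos hδ (by positivity)).le, mul_inv_cancel₀] at hab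
      · simpa [mul_assoc, div_mul_cancel₀ _ (by positivity : (max ‖a‖ 1) > 0).ne'] using hab
      · simp [hdeg]
      · positivity
    rw [Polynomial.aroots_def, Splits.roots_map ((IsAlgClosed.splits g).map _),
        Multiset.mem_map] at hb
    obtain ⟨c, _, rfl⟩ := hb
    exact ⟨c, hab⟩
  -- The approximating roots lie in K, hence in L; as L is complete, it is closed in the splitting
  -- field and contains their limit a.
  have hclosed : IsClosed (Set.range (algebraMap L F)) :=
    (algebraMap_isometry L F).isClosedEmbedding.isClosed_range
  have hmem : a ∈ closure (Set.range (algebraMap L F)) := by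
    rw [Metric.mem_closure_range_iff]
    intro δ hδ
    obtain ⟨b, hb⟩ := happrox δ hδ
    exact ⟨b, (dist_eq_norm_sub a (algebraMap L F b)).trans_lt hb⟩
  obtain ⟨b, hb⟩ := hclosed.closure_eq ▸ hmem
  refine ⟨b, (algebraMap L F).injective ?_⟩
  rwa [← Polynomial.aeval_algebraMap_apply_eq_algebraMap_eval, hb, map_zero]

/-! ### Absolute value and characteristic of ℂ_∞. -/

section CInfField

variable (F : Type*) [Field F] [Finite F]

instance isUltrametricDist_CInf : IsUltrametricDist (CInf F) :=
  IsUltrametricDist.of_normedAlgebra (KInf F)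

instance isAlgClosed_CInf : IsAlgClosed (CInf F) :=
  isAlgClosed_of_denseRange (K := KInfAlg F) UniformSpace.Completion.denseRange_coe

theorem isClosed_range_KInf : IsClosed (Set.range (algebraMap (KInf F) (CInf F))) :=
  (algebraMap_isometry (KInf F) (CInf F)).isClosedEmbedding.isClosed_range

variable {F}

theorem norm_ofK (x : K F) (hx : x ≠ 0) : ‖ofK x‖ = (Nat.card F : ℝ) ^ x.intDegree := by
  classical
  have h : Valued.v (algebraMap (RatFunc F) (KInf F) x) = WithZero.exp x.intDegree := by
    let _ := RatFunc.inftyValued F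
    exact (RatFunc.valuedCompletionAtInfty.def F).trans
      ((Valued.extensionValuation_apply_coe (K := RatFunc F) x).trans
        (RatFunc.inftyValuation_of_nonzero F hx))
  rw [ofK, RingHom.comp_apply, norm_algebraMap']
  change ((WithZeroMulInt.toNNReal (one_lt_card F).ne_zero
    (MonoidWithZeroHom.ValueGroup₀.embedding ((Valued.v : Valuation (KInf F) _).restrict _)) :
      ℝ≥0) : ℝ) = _
  rw [Valuation.embedding_restrict, h]
  rw [WithZeroMulInt.toNNReal_neg_apply _ WithZero.exp_ne_zero]
  simp [WithZero.exp]

theorem norm_ofA {a : A F} (ha : a ≠ 0) : ‖ofA a‖ = (Nat.card F : ℝ) ^ a.natDegree := by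
  have h := norm_ofK (algebraMap (A F) (K F) a) (by simpa using ha)
  rw [RatFunc.intDegree_polynomial] at h
  exact_mod_cast h

/-- The source of every cancellation below: sums of q equal terms vanish, and integers congruent to
1 modulo q become 1. -/
theorem card_eq_zero : (Nat.card F : CInf F) = 0 := by
  have : Fintype F := Fintype.ofFinite F
  rw [Nat.card_eq_fintype_card, ← map_natCast ((ofA (F := F)).comp C)]
  simp

end CInfField

theorem norm_sub_le_max {G : Type*} [SeminormedAddCommGroup G] [IsUltrametricDist G] (x y : G) :
    ‖x - y‖ ≤ max ‖x‖ ‖y‖ := by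
  simpa [sub_eq_add_neg] using IsUltrametricDist.norm_add_le_max x (-y)

/-! ### Power series on nonarchimedean balls and their uniform limits. -/

section PowerSeriesOnBall

variable {𝕜 : Type*} [NontriviallyNormedField 𝕜]

/-- `f` is the sum of the power series `∑ a n * ε ^ n` on the open ball of radius `r` around `0`,
and `‖a n‖ * r ^ n` is bounded. -/
def SumsOnBall (r : ℝ) (a : ℕ → 𝕜) (f : 𝕜 → 𝕜) : Prop :=
  (∃ B, ∀ n, ‖a n‖ * r ^ n ≤ B) ∧ ∀ ε, ‖ε‖ < r → HasSum (fun n => a n * ε ^ n) (f ε)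

theorem summable_norm_of_bound {r B : ℝ} {a : ℕ → 𝕜} (h : ∀ n, ‖a n‖ * r ^ n ≤ B) {ε : 𝕜}
    (hε : ‖ε‖ < r) : Summable fun n => ‖a n * ε ^ n‖ := by
  have hr : 0 < r := (norm_nonneg ε).trans_lt hε
  have hlt : ‖ε‖ / r < 1 := (div_lt_one hr).2 hε
  refine Summable.of_nonneg_of_le (fun _ => norm_nonneg _) (fun n => ?_)
    ((summable_geometric_of_lt_one (by positivity) hlt).mul_left B)
  rw [norm_mul, norm_pow, div_pow]
  calc ‖a n‖ * ‖ε‖ ^ n = ‖a n‖ * r ^ n * (‖ε‖ ^ n / r ^ n) := by field_simp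
    _ ≤ B * (‖ε‖ ^ n / r ^ n) := mul_le_mul_of_nonneg_right (h n) (by positivity)

namespace SumsOnBall

variable {r : ℝ} {a b : ℕ → 𝕜} {f g : 𝕜 → 𝕜}

theorem mono (h : SumsOnBall r a f) {s : ℝ} (hs : 0 ≤ s) (hsr : s ≤ r) : SumsOnBall s a f := by
  obtain ⟨⟨B, hB⟩, hf⟩ := h
  refine ⟨⟨B, fun n => le_trans ?_ (hB n)⟩, fun ε hε => hf ε (hε.trans_le hsr)⟩
  gcongr

theorem const (c : 𝕜) : SumsOnBall r (Pi.single 0 c) (fun _ => c) := by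
  refine ⟨⟨‖c‖, fun n => ?_⟩, fun ε _ => ?_⟩
  · rcases eq_or_ne n 0 with rfl | hn
    · simp
    · simp [Pi.single_eq_of_ne hn]
  · convert hasSum_single (f := fun n => (Pi.single 0 c : ℕ → 𝕜) n * ε ^ n) 0 ?_ using 1
    · simp
    · intro n hn
      simp [Pi.single_eq_of_ne hn]

theorem id (hr : 0 < r) : SumsOnBall r (Pi.single 1 (1 : 𝕜)) (fun ε => ε) := by
  refine ⟨⟨r, fun n => ?_⟩, fun ε _ => ?_⟩
  · rcases eq_or_ne n 1 with rfl | hn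
    · simp
    · simp [Pi.single_eq_of_ne hn, hr.le]
  · convert hasSum_single (f := fun n => (Pi.single 1 (1 : 𝕜) : ℕ → 𝕜) n * ε ^ n) 1 ?_ using 1
    · simp
    · intro n hn
      simp [Pi.single_eq_of_ne hn]

theorem congr (h : SumsOnBall r a f) (hfg : ∀ ε, ‖ε‖ < r → f ε = g ε) : SumsOnBall r a g :=
  ⟨h.1, fun ε hε => hfg ε hε ▸ h.2 ε hε⟩

theorem add (hr : 0 < r) (hf : SumsOnBall r a f) (hg : SumsOnBall r b g) :
    SumsOnBall r (a + b) (f + g) := by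
  obtain ⟨⟨B, hB⟩, hf⟩ := hf
  obtain ⟨⟨B', hB'⟩, hg⟩ := hg
  refine ⟨⟨B + B', fun n => ?_⟩, fun ε hε => ?_⟩
  · calc ‖a n + b n‖ * r ^ n ≤ (‖a n‖ + ‖b n‖) * r ^ n := by gcongr; exact norm_add_le _ _
      _ ≤ B + B' := by rw [add_mul]; exact add_le_add (hB n) (hB' n)
  · simpa only [Pi.add_apply, add_mul] using (hf ε hε).add (hg ε hε)

theorem const_smul (c : 𝕜) (hf : SumsOnBall r a f) : SumsOnBall r (c • a) (c • f) := by
  obtain ⟨⟨B, hB⟩, hf⟩ := hf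
  refine ⟨⟨‖c‖ * B, fun n => ?_⟩, fun ε hε => ?_⟩
  · rw [Pi.smul_apply, smul_eq_mul, norm_mul, mul_assoc]
    exact mul_le_mul_of_nonneg_left (hB n) (norm_nonneg c)
  · simpa only [Pi.smul_apply, smul_eq_mul, mul_assoc] using (hf ε hε).mul_left c

theorem sub (hr : 0 < r) (hf : SumsOnBall r a f) (hg : SumsOnBall r b g) :
    SumsOnBall r (a - b) (f - g) := by
  simpa [sub_eq_add_neg] using hf.add hr (hg.const_smul (-1))

theorem sum (hr : 0 < r) {ι : Type*} (s : Finset ι) {f : ι → 𝕜 → 𝕜}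
    (h : ∀ i ∈ s, ∃ a, SumsOnBall r a (f i)) : ∃ a, SumsOnBall r a (fun ε => ∑ i ∈ s, f i ε) := by
  classical
  induction s using Finset.induction_on with
  | empty => exact ⟨_, by simpa using const (0 : 𝕜)⟩
  | insert i s his ih =>
    obtain ⟨a, ha⟩ := h i (Finset.mem_insert_self i s)
    obtain ⟨b, hb⟩ := ih fun j hj => h j (Finset.mem_insert_of_mem hj)
    exact ⟨_, (ha.add hr hb).congr fun ε _ => by simp [Finset.sum_insert his]⟩

theorem mul [CompleteSpace 𝕜] [IsUltrametricDist 𝕜] (hr : 0 < r) (hf : SumsOnBall r a f)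
    (hg : SumsOnBall r b g) :
    SumsOnBall r (fun n => ∑ k ∈ Finset.range (n + 1), a k * b (n - k)) (f * g) := by
  obtain ⟨⟨B, hB⟩, hf⟩ := hf
  obtain ⟨⟨B', hB'⟩, hg⟩ := hg
  have hB0 : 0 ≤ B := le_trans (by positivity) (hB 0)
  have hB0' : 0 ≤ B' := le_trans (by positivity) (hB' 0)
  refine ⟨⟨B * B', fun n => ?_⟩, fun ε hε => ?_⟩
  · rw [← le_div_iff₀ (by positivity)]
    refine IsUltrametricDist.norm_sum_le_of_forall_le_of_nonneg (by positivity) fun k hk => ?_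
    rw [le_div_iff₀ (by positivity), norm_mul]
    have hk : k ≤ n := by simpa [Nat.lt_succ_iff] using hk
    calc ‖a k‖ * ‖b (n - k)‖ * r ^ n = (‖a k‖ * r ^ k) * (‖b (n - k)‖ * r ^ (n - k)) := by
          rw [← Nat.add_sub_cancel' hk, pow_add, Nat.add_sub_cancel_left]; ring
      _ ≤ B * B' := mul_le_mul (hB k) (hB' _) (by positivity) hB0
  · have h := hasSum_sum_range_mul_of_summable_norm (summable_norm_of_bound hB hε)
      (summable_norm_of_bound hB' hε)
    rw [(hf ε hε).tsum_eq, (hg ε hε).tsum_eq] at h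
    refine h.congr_fun fun n => ?_
    rw [Finset.sum_mul]
    refine Finset.sum_congr rfl fun k hk => ?_
    have hk : k ≤ n := by simpa [Nat.lt_succ_iff] using hk
    have hpow : ε ^ n = ε ^ k * ε ^ (n - k) := by rw [← pow_add, Nat.add_sub_cancel' hk]
    rw [hpow]
    ring

theorem inv_sub (hr : 0 < r) {α : 𝕜} (hα : r ≤ ‖α‖) :
    SumsOnBall r (fun n => -(α⁻¹ ^ (n + 1))) (fun ε => (ε - α)⁻¹) := by
  have hα0 : α ≠ 0 := norm_pos_iff.1 (hr.trans_le hα)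
  refine ⟨⟨‖α‖⁻¹, fun n => ?_⟩, fun ε hε => ?_⟩
  · rw [norm_neg, norm_pow, norm_inv, pow_succ]
    have : (‖α‖⁻¹ ^ n) * r ^ n ≤ 1 := by
      rw [← mul_pow]
      refine pow_le_one₀ (by positivity) ?_
      rw [inv_mul_le_iff₀ (hr.trans_le hα)]
      simpa using hα
    calc ‖α‖⁻¹ ^ n * ‖α‖⁻¹ * r ^ n = ‖α‖⁻¹ ^ n * r ^ n * ‖α‖⁻¹ := by ring
      _ ≤ 1 * ‖α‖⁻¹ := by gcongr
      _ = _ := one_mul _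
  · have hlt : ‖α⁻¹ * ε‖ < 1 := by
      rw [norm_mul, norm_inv, inv_mul_lt_iff₀ (hr.trans_le hα)]
      simpa using hε.trans_le hα
    have hval : (ε - α)⁻¹ = -α⁻¹ * (1 - α⁻¹ * ε)⁻¹ := by
      rw [neg_mul, ← mul_inv, mul_sub, mul_inv_cancel_left₀ hα0, mul_one, ← inv_neg, neg_sub]
    change HasSum _ (ε - α)⁻¹
    rw [hval]
    refine ((hasSum_geometric_of_norm_lt_one hlt).mul_left (-α⁻¹)).congr_fun fun n => ?_
    simp only [mul_pow, pow_succ]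
    ring

theorem polynomial [CompleteSpace 𝕜] [IsUltrametricDist 𝕜] (hr : 0 < r) (P : 𝕜[X]) :
    ∃ a, SumsOnBall r a (fun ε => P.eval ε) := by
  induction P using Polynomial.induction_on' with
  | add p q hp hq =>
    obtain ⟨a, ha⟩ := hp
    obtain ⟨b, hb⟩ := hq
    exact ⟨_, (ha.add hr hb).congr fun ε _ => by simp⟩
  | monomial n c =>
    induction n with
    | zero => exact ⟨_, (const c).congr fun ε _ => by simp⟩
    | succ n ih =>
      obtain ⟨a, ha⟩ := ih
      exact ⟨_, (ha.mul hr (id hr)).congr fun ε _ => by simp [pow_succ, mul_assoc]⟩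

/-- Over an algebraically closed field Q splits, and its roots lie outside the ball, so the inverse
of each linear factor is a geometric series. -/
theorem rational [CompleteSpace 𝕜] [IsUltrametricDist 𝕜] [IsAlgClosed 𝕜] (hr : 0 < r) (P Q : 𝕜[X])
    (hQ : ∀ ε, ‖ε‖ < r → Q.eval ε ≠ 0) :
    ∃ a, SumsOnBall r a (fun ε => P.eval ε / Q.eval ε) := by
  have key : ∀ s : Multiset 𝕜, (∀ α ∈ s, r ≤ ‖α‖) →
      ∃ a, SumsOnBall r a (fun ε => ((s.map fun α => ε - α).prod)⁻¹) := by
    intro s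
    induction s using Multiset.induction_on with
    | empty => exact fun _ => ⟨_, by simpa using const (1 : 𝕜)⟩
    | cons α s ih =>
      intro hs
      obtain ⟨a, ha⟩ := ih fun β hβ => hs β (Multiset.mem_cons_of_mem hβ)
      exact ⟨_, ((inv_sub hr (hs α (Multiset.mem_cons_self α s))).mul hr ha).congr
        fun ε _ => by simp [mul_comm]⟩
  obtain ⟨a, ha⟩ := key Q.roots fun α hα => by
    by_contra! h
    exact hQ α h (isRoot_of_mem_roots hα)
  obtain ⟨b, hb⟩ := polynomial hr P
  refine ⟨_, ((hb.mul hr ha).const_smul Q.leadingCoeff⁻¹).congr fun ε _ => ?_⟩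
  rw [(IsAlgClosed.splits Q).eval_eq_prod_roots]
  simp only [Pi.smul_apply, Pi.mul_apply, smul_eq_mul, div_eq_mul_inv, mul_inv]
  ring

variable [IsUltrametricDist 𝕜] [IsAlgClosed 𝕜]

/-- Cauchy's estimate. -/
theorem norm_coeff_mul_le {q : ℕ} (hq : q ≠ 0) (hq0 : (q : 𝕜) = 0) (h : SumsOnBall r a f) {M : ℝ}
    (hM : ∀ ε, ‖ε‖ < r → ‖f ε‖ ≤ M) {ε : 𝕜} (hε : ‖ε‖ < r) (n : ℕ) : ‖a n‖ * ‖ε‖ ^ n ≤ M := by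
  obtain ⟨⟨B, hB⟩, hf⟩ := h
  have hM0 : 0 ≤ M := (norm_nonneg _).trans (hM ε hε)
  rw [← norm_pow, ← norm_mul]
  refine le_of_forall_pos_le_add fun τ hτ => ?_
  have htend := (summable_norm_of_bound hB hε).tendsto_atTop_zero
  obtain ⟨N₀, hN₀⟩ := eventually_atTop.1 (htend.eventually (gt_mem_nhds hτ))
  -- N is 1 in the field, so averaging over the N-th roots of unity needs no division; N > N₀ + n
  -- makes every aliased index j ≥ N fall where the terms are below τ.
  set N := q * (N₀ + n) + 1 with hNdef
  have hNn : N₀ + n < N := by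
    have := Nat.le_mul_of_pos_left (N₀ + n) (Nat.pos_of_ne_zero hq)
    omega
  have hN1 : (N : 𝕜) = 1 := by simp [hNdef, hq0]
  have : NeZero (N : 𝕜) := ⟨by simp [hN1]⟩
  obtain ⟨ζ, hζ⟩ := HasEnoughRootsOfUnity.exists_primitiveRoot 𝕜 N
  have hζ1 : ‖ζ‖ = 1 := (pow_eq_one_iff_of_nonneg (norm_nonneg ζ) (n := N) (by omega)).1
    (by rw [← norm_pow, hζ.pow_eq_one, norm_one])
  -- The character sum detecting j ≡ n modulo N; the shift by N - n avoids negative exponents.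
  set c : ℕ → 𝕜 := fun j => ∑ k ∈ Finset.range N, (ζ ^ (j + (N - n))) ^ k with hc
  have hc1 : ∀ j, ‖c j‖ ≤ 1 := fun j =>
    IsUltrametricDist.norm_sum_le_of_forall_le_of_nonneg zero_le_one fun k _ => by simp [hζ1]
  have hcn : c n = 1 := by
    have : n + (N - n) = N := by omega
    simp [hc, this, hζ.pow_eq_one, hN1]
  have hcj : ∀ j < N, j ≠ n → c j = 0 := by
    intro j hj hjn
    have hne : ζ ^ (j + (N - n)) ≠ 1 := by
      rw [Ne, hζ.pow_eq_one_iff_dvd]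
      rintro ⟨d, hd⟩
      have hd2 : d < 2 := by
        by_contra! h
        have := Nat.mul_le_mul_left N h
        omega
      interval_cases d <;> omega
    have := mul_geom_sum (ζ ^ (j + (N - n))) N
    rw [← pow_mul, mul_comm _ N, pow_mul, hζ.pow_eq_one, one_pow, sub_self] at this
    exact (mul_eq_zero.1 this).resolve_left (sub_ne_zero.2 hne)
  have hsum : HasSum (fun j => a j * ε ^ j * c j)
      (∑ k ∈ Finset.range N, ζ ^ ((N - n) * k) * f (ζ ^ k * ε)) := by
    have := hasSum_sum (s := Finset.range N) fun k (_ : k ∈ Finset.range N) =>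
      (hf (ζ ^ k * ε) (by simpa [hζ1] using hε)).mul_left (ζ ^ ((N - n) * k))
    refine this.congr_fun fun j => ?_
    rw [hc, Finset.mul_sum]
    refine Finset.sum_congr rfl fun k _ => ?_
    rw [mul_pow, ← pow_mul, ← pow_mul, add_mul, pow_add, mul_comm j k]
    ring
  have hv : ‖∑ k ∈ Finset.range N, ζ ^ ((N - n) * k) * f (ζ ^ k * ε)‖ ≤ M :=
    IsUltrametricDist.norm_sum_le_of_forall_le_of_nonneg hM0 fun k _ => by
      rw [norm_mul, norm_pow, hζ1, one_pow, one_mul]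
      exact hM _ (by simpa [hζ1] using hε)
  have htail := hsum.sub (hasSum_ite_eq n (a n * ε ^ n))
  have hle : ‖(∑ k ∈ Finset.range N, ζ ^ ((N - n) * k) * f (ζ ^ k * ε)) - a n * ε ^ n‖ ≤ τ := by
    rw [← htail.tsum_eq]
    refine IsUltrametricDist.norm_tsum_le_of_forall_le_of_nonneg hτ.le fun j => ?_
    by_cases hjn : j = n
    · subst hjn
      simpa [hcn] using hτ.le
    · rw [if_neg hjn, sub_zero]
      by_cases hj : j < N
      · simpa [hcj j hj hjn] using hτ.le
      · rw [norm_mul]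
        calc _ ≤ ‖a j * ε ^ j‖ * 1 := by gcongr; exact hc1 j
          _ ≤ τ := by rw [mul_one]; exact (hN₀ j (by omega)).le
  calc ‖a n * ε ^ n‖ = ‖(∑ k ∈ Finset.range N, ζ ^ ((N - n) * k) * f (ζ ^ k * ε)) -
        ((∑ k ∈ Finset.range N, ζ ^ ((N - n) * k) * f (ζ ^ k * ε)) - a n * ε ^ n)‖ := by
          rw [sub_sub_cancel]
    _ ≤ M + τ := (norm_sub_le _ _).trans (add_le_add hv hle)

/-- A uniform limit of sums of power series on a ball is the sum of a power series on every
smaller ball. -/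
theorem of_uniform_limit [CompleteSpace 𝕜] {q : ℕ} (hq : q ≠ 0) (hq0 : (q : 𝕜) = 0) {ρ : 𝕜} (hρ0 : ρ ≠ 0)
    (hρ : ‖ρ‖ < r)
    (h : ∀ δ > 0, ∃ g a, SumsOnBall r a g ∧ ∀ ε, ‖ε‖ < r → ‖f ε - g ε‖ ≤ δ) :
    ∃ a, SumsOnBall ‖ρ‖ a f := by
  have hρ' : 0 < ‖ρ‖ := norm_pos_iff.2 hρ0
  have hr : 0 < r := hρ'.trans hρ
  obtain ⟨δ, -, hδ0, hδ⟩ := exists_seq_strictAnti_tendsto (0 : ℝ)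
  choose g b hb hg using fun k => h (δ k) (hδ0 k)
  have hdiff : ∀ k l ε, ‖ε‖ < r → ‖g k ε - g l ε‖ ≤ max (δ k) (δ l) := by
    intro k l ε hε
    have : g k ε - g l ε = (f ε - g l ε) - (f ε - g k ε) := by ring
    rw [this]
    refine (norm_sub_le_max _ _).trans ?_
    rw [max_comm]
    exact max_le_max (hg k ε hε) (hg l ε hε)
  -- Cauchy's estimate turns uniform closeness of functions into closeness of coefficients. It is
  -- evaluated at an actual point ρ of the open ball, hence the loss of radius.
  have hcoeff : ∀ k l n, ‖b k n - b l n‖ * ‖ρ‖ ^ n ≤ max (δ k) (δ l) := fun k l n =>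
    ((hb k).sub hr (hb l)).norm_coeff_mul_le hq hq0 (hdiff k l) hρ n
  have hcauchy : ∀ n, CauchySeq fun k => b k n := by
    intro n
    rw [Metric.cauchySeq_iff]
    intro τ hτ
    obtain ⟨N, hN⟩ := eventually_atTop.1
      (hδ.eventually (gt_mem_nhds (show 0 < τ * ‖ρ‖ ^ n by positivity)))
    refine ⟨N, fun k hk l hl => ?_⟩
    rw [dist_eq_norm_sub]
    have := (hcoeff k l n).trans_lt (max_lt (hN k hk) (hN l hl))
    exact lt_of_mul_lt_mul_right this (by positivity)
  choose a ha using fun n => cauchySeq_tendsto_of_complete (hcauchy n)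
  have hlim : ∀ k n, ‖a n - b k n‖ * ‖ρ‖ ^ n ≤ δ k := by
    intro k n
    have h1 : Tendsto (fun l => ‖b l n - b k n‖ * ‖ρ‖ ^ n) atTop (𝓝 (‖a n - b k n‖ * ‖ρ‖ ^ n)) :=
      ((ha n).sub_const _).norm.mul_const _
    have h2 : Tendsto (fun l => max (δ l) (δ k)) atTop (𝓝 (max 0 (δ k))) :=
      hδ.max tendsto_const_nhds
    rw [max_eq_right (hδ0 k).le] at h2
    exact le_of_tendsto_of_tendsto' h1 h2 fun l => hcoeff l k n
  have hbound : ∃ B, ∀ n, ‖a n‖ * ‖ρ‖ ^ n ≤ B := by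
    obtain ⟨B, hB⟩ := ((hb 0).mono hρ'.le hρ.le).1
    refine ⟨δ 0 + B, fun n => ?_⟩
    calc ‖a n‖ * ‖ρ‖ ^ n ≤ (‖a n - b 0 n‖ + ‖b 0 n‖) * ‖ρ‖ ^ n := by
          gcongr
          simpa using norm_add_le (a n - b 0 n) (b 0 n)
      _ ≤ δ 0 + B := by rw [add_mul]; exact add_le_add (hlim 0 n) (hB n)
  refine ⟨a, hbound, fun ε hε => ?_⟩
  obtain ⟨B, hB⟩ := hbound
  have hs := (summable_norm_of_bound hB hε).of_norm
  have hle : ∀ k, ‖f ε - ∑' n, a n * ε ^ n‖ ≤ δ k := by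
    intro k
    have hk := (hb k).2 ε (hε.trans hρ)
    have h1 : ‖(∑' n, a n * ε ^ n) - g k ε‖ ≤ δ k := by
      rw [← (hs.hasSum.sub hk).tsum_eq]
      refine IsUltrametricDist.norm_tsum_le_of_forall_le_of_nonneg (hδ0 k).le fun n => ?_
      rw [← sub_mul, norm_mul, norm_pow]
      refine le_trans ?_ (hlim k n)
      gcongr
    have : f ε - ∑' n, a n * ε ^ n = (f ε - g k ε) - ((∑' n, a n * ε ^ n) - g k ε) := by ring
    rw [this]
    exact (norm_sub_le_max _ _).trans (max_le (hg k ε (hε.trans hρ)) h1)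
  rw [sub_eq_zero.1 (norm_le_zero_iff.1 (ge_of_tendsto' hδ hle))]
  exact hs.hasSum

end SumsOnBall

end PowerSeriesOnBall

/-! ### Local expansions on Ω and hyperderivatives. -/

section Expansions

variable {F : Type*} [Field F] [Finite F]

/-- `f(z + ε) = ∑ a i * ε ^ i` for all small `ε`. -/
def HasExpansion (f : Omega F → CInf F) (z : Omega F) (a : ℕ → CInf F) : Prop :=
  ∀ᶠ ε in 𝓝 (0 : CInf F),
    ∃ hε : (z : CInf F) + ε ∉ Set.range (algebraMap (KInf F) (CInf F)),
      HasSum (fun i => a i * ε ^ i) (f ⟨z + ε, hε⟩)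

/-- Makes the choice inside `hyperDeriv` immaterial, so that any explicit expansion computes the
hyperderivatives. -/
theorem HasExpansion.unique {f : Omega F → CInf F} {z : Omega F} {a b : ℕ → CInf F}
    (ha : HasExpansion f z a) (hb : HasExpansion f z b) : a = b := by
  classical
  let g : CInf F → CInf F := fun w =>
    if hw : w ∉ Set.range (algebraMap (KInf F) (CInf F)) then f ⟨w, hw⟩ else 0
  have key : ∀ c : ℕ → CInf F, HasExpansion f z c →
      HasFPowerSeriesAt g (FormalMultilinearSeries.ofScalars (CInf F) c) (z : CInf F) := by
    intro c hc
    rw [hasFPowerSeriesAt_iff]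
    filter_upwards [hc] with ε hε
    obtain ⟨h1, h2⟩ := hε
    have : g (z + ε) = f ⟨z + ε, h1⟩ := dif_pos h1
    rw [this]
    refine h2.congr_fun fun n => ?_
    rw [FormalMultilinearSeries.coeff_ofScalars, smul_eq_mul, mul_comm]
  have h := (key a ha).eq_formalMultilinearSeries (key b hb)
  funext n
  simpa only [FormalMultilinearSeries.coeff_ofScalars] using
    congrArg (fun p => FormalMultilinearSeries.coeff p n) h

theorem hyperDeriv_eq {f : Omega F → CInf F} {z : Omega F} {a : ℕ → CInf F}
    (ha : HasExpansion f z a) (n : ℕ) : hyperDeriv n f z = a n := by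
  have h : ∃ a, HasExpansion f z a := ⟨a, ha⟩
  have : hyperDeriv n f z = h.choose n := dif_pos h
  rw [this, h.choose_spec.unique ha]

theorem hasExpansion_hyperDeriv {f : Omega F → CInf F} {z : Omega F}
    (h : ∃ a, HasExpansion f z a) : HasExpansion f z (fun n => hyperDeriv n f z) := by
  obtain ⟨a, ha⟩ := h
  simpa only [hyperDeriv_eq ha] using ha

/-- K_∞ is complete, hence closed in ℂ_∞, so a point outside it has positive distance from it. -/
theorem exists_forall_le_norm_sub (z : Omega F) :
    ∃ δ > 0, ∀ x : KInf F, δ ≤ ‖(z : CInf F) - algebraMap (KInf F) (CInf F) x‖ := by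
  have hpos := ((isClosed_range_KInf F).notMem_iff_infDist_pos ⟨_, 0, rfl⟩).1 z.2
  refine ⟨_, hpos, fun x => ?_⟩
  rw [← dist_eq_norm_sub]
  exact Metric.infDist_le_dist_of_mem ⟨x, rfl⟩

theorem norm_add_eq_of_lt {x y : CInf F} (h : ‖y‖ < ‖x‖) : ‖x + y‖ = ‖x‖ := by
  rw [IsUltrametricDist.norm_add_eq_max_of_norm_ne_norm h.ne', max_eq_left h.le]

theorem add_notMem_range {z : Omega F} {δ : ℝ}
    (hδ : ∀ x : KInf F, δ ≤ ‖(z : CInf F) - algebraMap (KInf F) (CInf F) x‖) {ε : CInf F}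
    (hε : ‖ε‖ < δ) : (z : CInf F) + ε ∉ Set.range (algebraMap (KInf F) (CInf F)) := by
  rintro ⟨x, hx⟩
  have h := hδ x
  rw [hx, sub_add_cancel_left, norm_neg] at h
  exact absurd hε (not_lt.2 h)

theorem exists_hasExpansion_of_approx {f : Omega F → CInf F} {z : Omega F} {r : ℝ} (hr : 0 < r)
    (hΩ : ∀ ε : CInf F, ‖ε‖ < r → (z : CInf F) + ε ∉ Set.range (algebraMap (KInf F) (CInf F)))
    (h : ∀ δ > 0, ∃ g a, SumsOnBall r a g ∧
      ∀ ε (hε : ‖ε‖ < r), ‖f ⟨z + ε, hΩ ε hε⟩ - g ε‖ ≤ δ) :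
    ∃ a, HasExpansion f z a := by
  classical
  obtain ⟨ρ, hρ0, hρ⟩ := NormedField.exists_norm_lt (CInf F) hr
  let g : CInf F → CInf F := fun ε =>
    if hε : ‖ε‖ < r then f ⟨z + ε, hΩ ε hε⟩ else 0
  have hg : ∀ ε (hε : ‖ε‖ < r), g ε = f ⟨z + ε, hΩ ε hε⟩ := fun ε hε => dif_pos hε
  obtain ⟨a, ha⟩ := SumsOnBall.of_uniform_limit (f := g) (Nat.card_pos (α := F)).ne' card_eq_zero
    (norm_pos_iff.1 hρ0) hρ fun δ hδ => by
      obtain ⟨k, b, hb, hk⟩ := h δ hδ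
      exact ⟨k, b, hb, fun ε hε => by rw [hg ε hε]; exact hk ε hε⟩
  refine ⟨a, ?_⟩
  filter_upwards [Metric.ball_mem_nhds (0 : CInf F) hρ0] with ε hε
  have hε' : ‖ε‖ < ‖ρ‖ := by simpa using hε
  exact ⟨hΩ ε (hε'.trans hρ), hg ε (hε'.trans hρ) ▸ ha.2 ε hε'⟩

/-- For n large the ball of radius q^(-n) about z lies in Ω_n, because perturbations smaller than |z
- x| leave that distance unchanged. On this ball the rational approximants have no poles, so they
are power series, and so is their uniform limit on a smaller ball. -/
theorem IsRigidAnalytic.exists_hasExpansion {f : Omega F → CInf F} (hf : IsRigidAnalytic f)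
    (z : Omega F) : ∃ a, HasExpansion f z a := by
  have hq : (1 : ℝ) < Nat.card F := by exact_mod_cast Finite.one_lt_card
  obtain ⟨δ, hδ0, hδ⟩ := exists_forall_le_norm_sub z
  obtain ⟨n, hn⟩ := pow_unbounded_of_one_lt (max ‖(z : CInf F)‖ δ⁻¹) hq
  have hqn : 0 < (Nat.card F : ℝ) ^ n := by positivity
  set r := ((Nat.card F : ℝ) ^ n)⁻¹ with hrdef
  have hr : 0 < r := inv_pos.2 hqn
  have hrδ : r ≤ δ := (inv_le_comm₀ hqn hδ0).2 ((le_max_right _ _).trans hn.le)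
  have hr1 : r ≤ (Nat.card F : ℝ) ^ n :=
    (inv_le_one_of_one_le₀ (one_le_pow₀ hq.le)).trans (one_le_pow₀ hq.le)
  have hΩ : ∀ ε : CInf F, ‖ε‖ < r →
      (z : CInf F) + ε ∉ Set.range (algebraMap (KInf F) (CInf F)) :=
    fun ε hε => add_notMem_range hδ (hε.trans_le hrδ)
  have haff : ∀ ε (hε : ‖ε‖ < r), (⟨z + ε, hΩ ε hε⟩ : Omega F) ∈ affinoid F n := by
    refine fun ε hε => ⟨?_, fun x => ?_⟩
    · exact (IsUltrametricDist.norm_add_le_max _ _).trans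
        (max_le ((le_max_left _ _).trans hn.le) (hε.le.trans hr1))
    · have h : ‖((z : CInf F) - algebraMap (KInf F) (CInf F) x) + ε‖ =
          ‖(z : CInf F) - algebraMap (KInf F) (CInf F) x‖ :=
        norm_add_eq_of_lt (hε.trans_le (hrδ.trans (hδ x)))
      change r ≤ ‖(z : CInf F) + ε - algebraMap (KInf F) (CInf F) x‖
      rw [add_sub_right_comm, h]
      exact hrδ.trans (hδ x)
  refine exists_hasExpansion_of_approx hr hΩ fun τ hτ => ?_
  obtain ⟨P, Q, hPQ⟩ := hf n τ hτ
  obtain ⟨a, ha⟩ := SumsOnBall.rational hr (P.comp (X + C (z : CInf F))) (Q.comp (X + C (z : CInf F)))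
    fun ε hε => by
      have := (hPQ _ (haff ε hε)).1
      simpa [add_comm] using this
  exact ⟨_, a, ha, fun ε hε => by simpa [add_comm] using (hPQ _ (haff ε hε)).2⟩

theorem hasSum_sum_antidiagonal {T : ℕ × ℕ → CInf F} {S : CInf F} (h : HasSum T S) :
    HasSum (fun n => ∑ p ∈ Finset.HasAntidiagonal.antidiagonal n, T p) S :=
  (Finset.HasAntidiagonal.sigmaAntidiagonalEquivProd.hasSum_iff.2 h).sigma fun n =>
    (Finset.hasSum (Finset.HasAntidiagonal.antidiagonal n) T)

/-- The Taylor coefficients at `z / (cz + 1)` of a function satisfying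
`g(z / (cz + 1)) = (cz + 1) ^ N * g(z) + κ * c * (cz + 1)`. -/
theorem HasExpansion.of_transformation {g : Omega F → CInf F} {z z₁ : Omega F} {a : ℕ → CInf F}
    (ha : HasExpansion g z a) (c κ : CInf F) {N : ℕ} (hN : 1 ≤ N) (hJ : c * z + 1 ≠ 0)
    (hz₁ : (z₁ : CInf F) * (c * z + 1) = z)
    (hg : ∀ w w₁ : Omega F, (w₁ : CInf F) * (c * w + 1) = w →
      g w₁ = (c * w + 1) ^ N * g w + κ * c * (c * w + 1)) :
    HasExpansion g z₁ fun n => (c * z + 1) ^ (N + 2 * n) *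
      ∑ j ∈ Finset.range (n + 1), (Nat.choose (N + n - 1) j : CInf F) *
        (c / (c * z + 1)) ^ j * a (n - j) + κ * (c * (c * z + 1)) ^ (n + 1) := by
  set J := c * (z : CInf F) + 1 with hJdef
  obtain ⟨δ, hδ0, hδ⟩ := exists_forall_le_norm_sub z₁
  -- Convergence at one nonzero point bounds the coefficients, which later gives absolute
  -- summability of the double series.
  obtain ⟨ε₀, hε₀0, B, hB⟩ : ∃ ε₀ : CInf F, 0 < ‖ε₀‖ ∧ ∃ B, ∀ n, ‖a n‖ * ‖ε₀‖ ^ n ≤ B := by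
    obtain ⟨s, hs, h⟩ := Metric.eventually_nhds_iff.1 ha
    obtain ⟨ε₀, h0, hlt⟩ := NormedField.exists_norm_lt (CInf F) hs
    obtain ⟨_, hsum⟩ := h (by simpa using hlt)
    obtain ⟨B, hB⟩ := hsum.summable.tendsto_atTop_zero.norm.bddAbove_range
    exact ⟨ε₀, h0, B, fun n => by simpa using hB ⟨n, rfl⟩⟩
  have ht1 : Tendsto (fun η : CInf F => c * J * η) (𝓝 0) (𝓝 0) := by
    have : Continuous fun η : CInf F => c * J * η := by fun_prop
    simpa using this.tendsto 0
  have ht2 : Tendsto (fun η : CInf F => J ^ 2 * η) (𝓝 0) (𝓝 0) := by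
    have : Continuous fun η : CInf F => J ^ 2 * η := by fun_prop
    simpa using this.tendsto 0
  have ht3 : Tendsto (fun η : CInf F => J ^ 2 * η / (1 - c * J * η)) (𝓝 0) (𝓝 0) := by
    have := ht2.div (ht1.const_sub 1) (by simp)
    rwa [zero_div] at this
  have hsmall : ∀ s > 0, ∀ᶠ x : CInf F in 𝓝 0, ‖x‖ < s := fun s hs => by
    filter_upwards [Metric.ball_mem_nhds (0 : CInf F) hs] with x hx
    simpa using hx
  filter_upwards [hsmall δ hδ0, ht1.eventually (hsmall 1 one_pos),
    ht2.eventually (hsmall _ hε₀0), ht3.eventually ha] with η h1 h2 h3 h4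
  refine ⟨add_notMem_range hδ h1, ?_⟩
  obtain ⟨hw, hsum⟩ := h4
  set u := c * J * η with hu
  have hu1 : 1 - u ≠ 0 := by
    intro h
    rw [sub_eq_zero] at h
    simp [← h] at h2
  -- The point w = z + J²η/(1-u) is the preimage of z₁ + η under w ↦ w/(cw+1).
  have hJw : c * ((z : CInf F) + J ^ 2 * η / (1 - u)) + 1 = J / (1 - u) := by
    rw [eq_div_iff hu1, add_mul, mul_assoc c, add_mul, div_mul_cancel₀ _ hu1, hu, hJdef]
    ring
  rw [hg ⟨_, hw⟩ ⟨_, add_notMem_range hδ h1⟩ (by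
    change ((z₁ : CInf F) + η) * (c * ((z : CInf F) + J ^ 2 * η / (1 - u)) + 1) =
      (z : CInf F) + J ^ 2 * η / (1 - u)
    rw [hJw]
    field_simp
    linear_combination hz₁ + (η * J) * hJdef - (z : CInf F) * hu)]
  change HasSum _ ((c * ((z : CInf F) + J ^ 2 * η / (1 - u)) + 1) ^ N * _ +
    κ * c * (c * ((z : CInf F) + J ^ 2 * η / (1 - u)) + 1))
  rw [hJw]
  set G := g ⟨_, hw⟩ with hG
  -- The index (s, i) records the power u^s from (1-u)^(-(N+i)) and the i-th Taylor term at z.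
  -- Summing over s first recovers the transformed function; regrouping along s + i = n gives its
  -- coefficients at z₁.
  let T : ℕ × ℕ → CInf F := fun p => J ^ N * (a p.2 * (J ^ 2 * η) ^ p.2) *
    ((Nat.choose (p.1 + (N + p.2 - 1)) (N + p.2 - 1) : CInf F) * u ^ p.1)
  have hT : Summable T := by
    have hs1 : Summable fun i => ‖a i * (J ^ 2 * η) ^ i‖ := summable_norm_of_bound hB h3
    have hs2 : Summable fun s : ℕ => ‖u‖ ^ s := summable_geometric_of_lt_one (norm_nonneg _) h2
    have hs := (hs2.mul_of_nonneg hs1 (fun _ => by positivity) (fun _ => norm_nonneg _)).mul_left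
      (‖J‖ ^ N)
    refine Summable.of_norm_bounded hs fun p => ?_
    simp only [T]
    rw [norm_mul, norm_mul, norm_mul (Nat.cast _), norm_pow, norm_pow]
    have := IsUltrametricDist.norm_natCast_le_one (CInf F)
      (Nat.choose (p.1 + (N + p.2 - 1)) (N + p.2 - 1))
    calc _ ≤ ‖J‖ ^ N * ‖a p.2 * (J ^ 2 * η) ^ p.2‖ * (1 * ‖u‖ ^ p.1) := by gcongr
      _ = _ := by ring
  have hTsum : HasSum T ((J / (1 - u)) ^ N * G) := by
    have hswap := (Equiv.prodComm ℕ ℕ).hasSum_iff.2 hT.hasSum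
    have hfib : ∀ i, HasSum (fun s => T (s, i))
        ((J / (1 - u)) ^ N * (a i * (J ^ 2 * η / (1 - u)) ^ i)) := by
      intro i
      have h := (hasSum_choose_mul_geometric_of_norm_lt_one (N + i - 1) h2).mul_left
        (J ^ N * (a i * (J ^ 2 * η) ^ i))
      have hval : J ^ N * (a i * (J ^ 2 * η) ^ i) * (1 / (1 - u) ^ (N + i - 1 + 1)) =
          (J / (1 - u)) ^ N * (a i * (J ^ 2 * η / (1 - u)) ^ i) := by
        rw [Nat.sub_add_cancel (by omega), pow_add, div_pow, div_pow]
        field_simp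
      rw [hval] at h
      exact h
    have h1 := hswap.prod_fiberwise hfib
    have h2 := hsum.mul_left ((J / (1 - u)) ^ N)
    rw [← h1.unique h2]
    exact hT.hasSum
  have hgeo : HasSum (fun n => κ * c * J * u ^ n) (κ * c * (J / (1 - u))) := by
    have := (hasSum_geometric_of_norm_lt_one h2).mul_left (κ * c * J)
    rwa [mul_assoc _ J, ← div_eq_mul_inv] at this
  refine ((hasSum_sum_antidiagonal hTsum).add hgeo).congr_fun fun n => ?_
  rw [add_mul, Finset.Nat.sum_antidiagonal_eq_sum_range_succ_mk, mul_assoc, Finset.sum_mul,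
    Finset.mul_sum]
  congr 1
  · refine Finset.sum_congr rfl fun j hj => ?_
    have hj : j ≤ n := by simpa [Nat.lt_succ_iff] using hj
    have hch : Nat.choose (j + (N + (n - j) - 1)) (N + (n - j) - 1) =
        Nat.choose (N + n - 1) j := by
      have : j + (N + (n - j) - 1) = N + n - 1 := by omega
      rw [this]
      exact (Nat.choose_symm_of_eq_add (by omega))
    have h1 : η ^ n = η ^ j * η ^ (n - j) := by rw [← pow_add, Nat.add_sub_cancel' hj]
    have h2 : J ^ (N + 2 * n) = J ^ N * (J ^ 2) ^ (n - j) * (J ^ j * J ^ j) := by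
      rw [← pow_mul, ← pow_add, ← pow_add, ← pow_add]
      congr 1
      omega
    simp only [T]
    rw [hch, h1, h2, hu, mul_pow, mul_pow, mul_pow, div_pow]
    field_simp
  · rw [hu, mul_pow _ η]
    ring

end Expansions

/-! ### Convergence and local expansion of the false Eisenstein series. -/

section FalseEisenstein

variable {F : Type*} [Field F] [Finite F]

theorem ofA_injective : Function.Injective (ofA (F := F)) := by
  rw [injective_iff_map_eq_zero]
  intro a h
  by_contra ha
  have := norm_ofA ha
  rw [h, norm_zero] at this
  have hq : (Nat.card F : ℝ) ≠ 0 := by exact_mod_cast (Nat.card_pos (α := F)).ne'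
  exact pow_ne_zero _ hq this.symm

theorem ofA_ne_zero {a : A F} (ha : a ≠ 0) : ofA a ≠ 0 := by
  simpa using ofA_injective.ne ha

theorem one_lt_card_real (F : Type*) [Field F] [Finite F] : (1 : ℝ) < Nat.card F := by
  exact_mod_cast Finite.one_lt_card

theorem norm_ofA_C_le (e : F) : ‖ofA (C e)‖ ≤ 1 := by
  rcases eq_or_ne e 0 with rfl | he
  · simp
  · rw [norm_ofA (by simpa using he)]
    simp

theorem norm_ofA_le_X_mul_add (b : A F) (e : F) : ‖ofA b‖ ≤ ‖ofA (X * b + C e)‖ := by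
  rcases eq_or_ne b 0 with rfl | hb
  · simp
  · have hdeg : (X * b + C e).natDegree = b.natDegree + 1 := by
      rw [natDegree_add_C, natDegree_X_mul hb]
    have hne : X * b + C e ≠ 0 := by
      intro h
      simp [h] at hdeg
    rw [norm_ofA hb, norm_ofA hne, hdeg]
    exact pow_le_pow_right₀ (one_lt_card_real F).le (Nat.le_succ _)

/-- The terms of the false Eisenstein series. -/
def eisTerm (a b : A F) (w : CInf F) : CInf F := ofA a / (ofA a * w + ofA b)

/-- The sum of the terms of the false Eisenstein series over a coset of the constants. -/
def eisBlock (p : A F × A F) (w : CInf F) : CInf F :=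
  ∑ᶠ e : F, eisTerm p.1 (X * p.2 + C e) w

theorem eisBlock_eq_sum [Fintype F] (p : A F × A F) (w : CInf F) :
    eisBlock p w = ∑ e : F, eisTerm p.1 (X * p.2 + C e) w :=
  finsum_eq_sum_of_fintype _

/-- `w` is far from `K_∞`, with constant `κ`. -/
def Separated (κ : ℝ) (w : CInf F) : Prop :=
  ∀ a b : A F, κ * max ‖ofA a‖ ‖ofA b‖ ≤ ‖ofA a * w + ofA b‖

theorem exists_separated (z : Omega F) : ∃ κ > 0, Separated κ (z : CInf F) := by
  obtain ⟨δ, hδ0, hδ⟩ := exists_forall_le_norm_sub z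
  have ha : ∀ a b : A F, δ * ‖ofA a‖ ≤ ‖ofA a * z + ofA b‖ := by
    intro a b
    rcases eq_or_ne a 0 with rfl | ha
    · simp
    · have ha' := ofA_ne_zero ha
      have h := hδ (-(algebraMap (K F) (KInf F) (algebraMap (A F) (K F) b) /
        algebraMap (K F) (KInf F) (algebraMap (A F) (K F) a)))
      rw [map_neg, map_div₀, sub_neg_eq_add] at h
      change δ ≤ ‖(z : CInf F) + ofA b / ofA a‖ at h
      calc δ * ‖ofA a‖ ≤ ‖(z : CInf F) + ofA b / ofA a‖ * ‖ofA a‖ := by gcongr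
        _ = _ := by
          rw [← norm_mul]
          congr 1
          field_simp
  have hM : 0 < max ‖(z : CInf F)‖ δ := lt_max_of_lt_right hδ0
  -- The entry δ handles |a|. If |az| < |b| the norm equals |b|, whence the entry 1; otherwise |b| ≤
  -- |a| max(|z|, δ), and the last entry reduces to the bound δ|a|. The δ inside the max only keeps
  -- the denominator positive.
  refine ⟨min δ (min 1 (δ / max ‖(z : CInf F)‖ δ)), by positivity, fun a b => ?_⟩
  set κ := min δ (min 1 (δ / max ‖(z : CInf F)‖ δ)) with hκ
  have hκ0 : 0 < κ := by positivity
  rw [mul_max_of_nonneg _ _ hκ0.le]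
  refine max_le (le_trans ?_ (ha a b)) ?_
  · gcongr
    exact min_le_left _ _
  · by_cases h : ‖ofA a * (z : CInf F)‖ < ‖ofA b‖
    · rw [add_comm, norm_add_eq_of_lt h]
      have : κ ≤ 1 := (min_le_right _ _).trans (min_le_left _ _)
      simpa using mul_le_mul_of_nonneg_right this (norm_nonneg (ofA b))
    · have h2 : κ ≤ δ / max ‖(z : CInf F)‖ δ := (min_le_right _ _).trans (min_le_right _ _)
      calc κ * ‖ofA b‖ ≤ δ / max ‖(z : CInf F)‖ δ * (‖ofA a‖ * max ‖(z : CInf F)‖ δ) := by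
            gcongr
            refine (not_lt.1 h).trans ?_
            rw [norm_mul]
            gcongr
            exact le_max_left _ _
        _ = δ * ‖ofA a‖ := by field_simp
        _ ≤ _ := ha a b

namespace Separated

variable {κ : ℝ} {w : CInf F}

theorem norm_pos (h : Separated κ w) (hκ : 0 < κ) {a b : A F} (hab : a ≠ 0 ∨ b ≠ 0) :
    0 < ‖ofA a * w + ofA b‖ := by
  refine lt_of_lt_of_le (mul_pos hκ ?_) (h a b)
  rcases hab with h | h
  · exact lt_max_of_lt_left (norm_pos_iff.2 (ofA_ne_zero h))
  · exact lt_max_of_lt_right (norm_pos_iff.2 (ofA_ne_zero h))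

theorem add_ne_zero (h : Separated κ w) (hκ : 0 < κ) {a b : A F} (hab : a ≠ 0 ∨ b ≠ 0) :
    ofA a * w + ofA b ≠ 0 :=
  norm_pos_iff.1 (h.norm_pos hκ hab)

/-- The constant κ survives small perturbations, so all later bounds are uniform near a point. -/
theorem add_small (h : Separated κ w) {ε : CInf F} (hε : ‖ε‖ < κ) : Separated κ (w + ε) := by
  intro a b
  rcases eq_or_ne a 0 with rfl | ha
  · simpa using h 0 b
  · have h1 : ‖ofA a * ε‖ < ‖ofA a * w + ofA b‖ := by
      refine lt_of_lt_of_le ?_ (h a b)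
      rw [norm_mul, mul_comm]
      have := norm_pos_iff.2 (ofA_ne_zero ha)
      calc ‖ε‖ * ‖ofA a‖ < κ * ‖ofA a‖ := by gcongr
        _ ≤ _ := mul_le_mul_of_nonneg_left (le_max_left _ _) ((norm_nonneg ε).trans hε.le)
    rw [mul_add, add_right_comm, norm_add_eq_of_lt h1]
    exact h a b

theorem norm_eisTerm_le (h : Separated κ w) (hκ : 0 < κ) (a b : A F) :
    ‖eisTerm a b w‖ ≤ ‖ofA a‖ / (κ * ‖ofA b‖) ∨ b = 0 := by
  rcases eq_or_ne b 0 with hb | hb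
  · exact Or.inr hb
  · left
    have hb' := norm_pos_iff.2 (ofA_ne_zero hb)
    rw [eisTerm, norm_div]
    gcongr
    exact (mul_le_mul_of_nonneg_left (le_max_right _ _) hκ.le).trans (h a b)

/-- Individual terms a/(aw+b) do not tend to 0 over pairs (a, b). In a block, subtracting q · a/x =
0 replaces a/(x+e) by -ae/(x(x+e)), gaining a factor of the size of the denominator. -/
theorem norm_eisBlock_le (h : Separated κ w) (hκ : 0 < κ) (p : A F × A F) :
    ‖eisBlock p w‖ ≤ (κ ^ 2)⁻¹ * (max ‖ofA p.1‖ ‖ofA p.2‖)⁻¹ := by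
  have : Fintype F := Fintype.ofFinite F
  obtain ⟨a, b⟩ := p
  rw [eisBlock_eq_sum]
  rcases eq_or_ne a 0 with rfl | ha
  · have h0 : ∀ b, eisTerm (0 : A F) b w = 0 := fun b => by simp [eisTerm]
    simp only [h0, Finset.sum_const_zero, norm_zero]
    positivity
  have ha' := ofA_ne_zero ha
  set m := max ‖ofA a‖ ‖ofA b‖ with hm
  have hm0 : 0 < m := lt_max_of_lt_left (norm_pos_iff.2 ha')
  have hle : ∀ e : F, κ * m ≤ ‖ofA a * w + ofA (X * b + C e)‖ := fun e =>
    (mul_le_mul_of_nonneg_left (max_le_max le_rfl (norm_ofA_le_X_mul_add b e)) hκ.le).trans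
      (h a _)
  set x := ofA a * w + ofA (X * b) with hx
  have hxe : ∀ e : F, ofA a * w + ofA (X * b + C e) = x + ofA (C e) := fun e => by
    rw [map_add, hx, add_assoc]
  have hx0 : κ * m ≤ ‖x‖ := by
    have := hle 0
    rw [hxe] at this
    simpa using this
  have hxne : x ≠ 0 := norm_pos_iff.1 ((mul_pos hκ hm0).trans_le hx0)
  have hsum : ∑ e : F, eisTerm a (X * b + C e) w =
      ∑ e : F, ofA a * -(ofA (C e)) / (x * (x + ofA (C e))) := by
    have hz : ∑ _e : F, ofA a / x = 0 := by
      rw [Finset.sum_const, Finset.card_univ, ← Nat.card_eq_fintype_card, nsmul_eq_mul,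
        card_eq_zero, zero_mul]
    rw [← sub_zero (∑ e : F, eisTerm a (X * b + C e) w), ← hz, ← Finset.sum_sub_distrib]
    refine Finset.sum_congr rfl fun e _ => ?_
    have hne : x + ofA (C e) ≠ 0 := by
      rw [← hxe]
      exact norm_pos_iff.1 ((mul_pos hκ hm0).trans_le (hle e))
    rw [eisTerm, hxe]
    field_simp
    ring
  rw [hsum]
  refine IsUltrametricDist.norm_sum_le_of_forall_le_of_nonneg (by positivity) fun e _ => ?_
  rw [norm_div, norm_mul, norm_mul, norm_neg]
  have h2 := hle e
  rw [hxe] at h2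
  calc ‖ofA a‖ * ‖ofA (C e)‖ / (‖x‖ * ‖x + ofA (C e)‖) ≤ m * 1 / ((κ * m) * (κ * m)) := by
        gcongr
        · exact le_max_left _ _
        · exact norm_ofA_C_le e
    _ = _ := by field_simp

end Separated

theorem finite_norm_ofA_le (R : ℝ) : {a : A F | ‖ofA a‖ ≤ R}.Finite := by
  obtain ⟨n, hn⟩ := pow_unbounded_of_one_lt R (one_lt_card_real F)
  have : Finite (degreeLT F n) := Module.finite_of_finite F
  refine (Set.toFinite (degreeLT F n : Set (A F))).subset fun a ha => ?_
  rw [SetLike.mem_coe, mem_degreeLT]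
  rcases eq_or_ne a 0 with rfl | h0
  · simp
  · rw [← natDegree_lt_iff_degree_lt h0]
    have h : ‖ofA a‖ ≤ R := ha
    rw [norm_ofA h0] at h
    exact (pow_lt_pow_iff_right₀ (one_lt_card_real F)).1 (h.trans_lt hn)

theorem finite_lt_inv_max {B τ : ℝ} (hτ : 0 < τ) :
    {p : A F × A F | τ < B * (max ‖ofA p.1‖ ‖ofA p.2‖)⁻¹}.Finite := by
  refine ((finite_norm_ofA_le (F := F) (B / τ)).prod (finite_norm_ofA_le (B / τ))).subset
    fun p hp => ?_
  have hp : τ < B * (max ‖ofA p.1‖ ‖ofA p.2‖)⁻¹ := hp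
  have hm : 0 < max ‖ofA p.1‖ ‖ofA p.2‖ := by
    refine lt_of_le_of_ne (le_max_of_le_left (norm_nonneg _)) fun h => ?_
    rw [← h] at hp
    simp only [inv_zero, mul_zero] at hp
    exact absurd hp (not_lt.2 hτ.le)
  rw [← div_eq_mul_inv, lt_div_iff₀ hm, mul_comm, ← lt_div_iff₀ hτ] at hp
  exact ⟨(le_max_left _ _).trans hp.le, (le_max_right _ _).trans hp.le⟩

namespace Separated

variable {κ : ℝ} {w : CInf F}

theorem summable_eisBlock (h : Separated κ w) (hκ : 0 < κ) :
    Summable fun p => eisBlock p w := by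
  refine NonarchimedeanAddGroup.summable_of_tendsto_cofinite_zero ?_
  rw [Metric.tendsto_nhds]
  intro τ hτ
  rw [eventually_cofinite]
  refine (finite_lt_inv_max (F := F) (B := (κ ^ 2)⁻¹) (half_pos hτ)).subset
    fun p hp => ?_
  have hp : ¬ dist (eisBlock p w) 0 < τ := hp
  rw [dist_zero_right, not_lt] at hp
  exact (half_lt_self hτ).trans_le (hp.trans (h.norm_eisBlock_le hκ p))

theorem summable_eisTerm (h : Separated κ w) (hκ : 0 < κ) (a : A F) :
    Summable fun b => eisTerm a b w := by
  refine NonarchimedeanAddGroup.summable_of_tendsto_cofinite_zero ?_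
  rw [Metric.tendsto_nhds]
  intro τ hτ
  rw [eventually_cofinite]
  refine ((finite_norm_ofA_le (F := F) (‖ofA a‖ / κ / τ)).union (Set.finite_singleton 0)).subset
    fun b hb => ?_
  have hb : ¬ dist (eisTerm a b w) 0 < τ := hb
  rw [dist_zero_right, not_lt] at hb
  rcases h.norm_eisTerm_le hκ a b with h1 | h1
  · left
    rcases eq_or_ne b 0 with rfl | hb0
    · simp only [map_zero, norm_zero, Set.mem_ofPred_eq]
      positivity
    · have hb' := norm_pos_iff.2 (ofA_ne_zero hb0)
      have := hb.trans h1
      rw [← div_div, le_div_iff₀ hb', mul_comm, ← le_div_iff₀ hτ] at this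
      exact this
  · exact Or.inr h1

end Separated

variable (F) in
/-- A polynomial is determined by its constant term and the quotient by `X`. -/
def divXEquiv : A F ≃ A F × F where
  toFun b := (b.divX, b.coeff 0)
  invFun p := X * p.1 + C p.2
  left_inv b := X_mul_divX_add b
  right_inv p := by
    ext1
    · ext n
      simp [coeff_divX]
    · simp

namespace Separated

variable {κ : ℝ} {w : CInf F}

/-- Matches the iterated sum, over b and then a, with the unconditional sum over blocks. -/
theorem hasSum_tsum_eisTerm (h : Separated κ w) (hκ : 0 < κ) :
    HasSum (fun a => ∑' b, eisTerm a b w) (∑' p, eisBlock p w) := by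
  have : Fintype F := Fintype.ofFinite F
  have hs := h.summable_eisBlock hκ
  refine hs.hasSum.prod_fiberwise fun a => ?_
  have h1 := (divXEquiv F).symm.hasSum_iff.2 (h.summable_eisTerm hκ a).hasSum
  refine h1.prod_fiberwise fun b => ?_
  rw [eisBlock_eq_sum]
  exact hasSum_fintype _

end Separated

theorem tsum_eisTerm_C_mul (u : Fˣ) (a : A F) (w : CInf F) :
    ∑' b, eisTerm (C (u : F) * a) b w = ∑' b, eisTerm a b w := by
  have hu : (C (u : F) : A F) ≠ 0 := by simp
  let e : A F ≃ A F :=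
    { toFun := fun b => C (u : F) * b
      invFun := fun b => C ((u⁻¹ : Fˣ) : F) * b
      left_inv := fun b => by simp [← mul_assoc, ← C_mul]
      right_inv := fun b => by simp [← mul_assoc, ← C_mul] }
  rw [← e.tsum_eq]
  refine tsum_congr fun b => ?_
  have hu' := ofA_ne_zero hu
  change ofA (C (u : F) * a) / (ofA (C (u : F) * a) * w + ofA (C (u : F) * b)) = _
  rw [map_mul, map_mul, mul_assoc, ← mul_add, mul_div_mul_left _ _ hu']
  rfl

/-- Each nonzero a is uniquely a unit times a monic polynomial. The q - 1 units contribute equally,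
and q - 1 = -1 in ℂ_∞. -/
theorem Separated.tsum_monic {κ : ℝ} {w : CInf F} (h : Separated κ w) (hκ : 0 < κ) :
    ∑' a : {a : A F // a.Monic}, ∑' b, eisTerm a.1 b w = -∑' p, eisBlock p w := by
  have : Fintype F := Fintype.ofFinite F
  classical
  set G : A F → CInf F := fun a => ∑' b, eisTerm a b w with hG
  let φ : {a : A F // a.Monic} × Fˣ → A F := fun p => C (p.2 : F) * p.1.1
  have hφ : Function.Injective φ := by
    rintro ⟨⟨a, ha⟩, u⟩ ⟨⟨b, hb⟩, v⟩ hab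
    have hab : C (u : F) * a = C (v : F) * b := hab
    have huv : (u : F) = v := by
      have := congrArg leadingCoeff hab
      simpa [leadingCoeff_mul, ha.leadingCoeff, hb.leadingCoeff] using this
    have hu : (C (u : F) : A F) ≠ 0 := by simp
    rw [← huv] at hab
    have := mul_left_cancel₀ hu hab
    subst this
    rw [Units.ext huv]
  have hrange : ∀ a ∉ Set.range φ, G a = 0 := by
    intro a ha
    rcases eq_or_ne a 0 with rfl | h0
    · simp [hG, eisTerm]
    · refine absurd ⟨⟨⟨C a.leadingCoeff⁻¹ * a, ?_⟩, Units.mk0 a.leadingCoeff (by simpa using h0)⟩, ?_⟩ ha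
      · rw [mul_comm]
        exact monic_mul_leadingCoeff_inv h0
      · change C a.leadingCoeff * (C a.leadingCoeff⁻¹ * a) = a
        rw [← mul_assoc, ← C_mul, mul_inv_cancel₀ (by simpa using h0), C_1, one_mul]
  have h1 := (hφ.hasSum_iff hrange).2 (h.hasSum_tsum_eisTerm hκ)
  have h2 := h1.prod_fiberwise (g := fun a => -G a.1) fun a => by
    have hconst : ∀ u : Fˣ, (G ∘ φ) (a, u) = G a.1 := fun u => tsum_eisTerm_C_mul u a.1 w
    have h3 := hasSum_fintype fun u : Fˣ => (G ∘ φ) (a, u)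
    simp only [hconst, Finset.sum_const, Finset.card_univ, Fintype.card_units] at h3
    rw [nsmul_eq_mul, ← Nat.card_eq_fintype_card, Nat.cast_pred Nat.card_pos, card_eq_zero,
      zero_sub, neg_one_mul] at h3
    simpa only [hconst] using h3
  have h3 := h2.neg
  simp only [neg_neg] at h3
  exact h3.tsum_eq

theorem falseE_eq (π : CInf F) (z : Omega F) :
    falseE π z = -π⁻¹ * ∑' p, eisBlock p (z : CInf F) := by
  obtain ⟨κ, hκ, h⟩ := exists_separated z
  have := h.tsum_monic hκ
  rw [neg_mul, ← mul_neg, ← this]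
  rfl

theorem falseE_exists_hasExpansion (π : CInf F) (z : Omega F) :
    ∃ a, HasExpansion (falseE π) z a := by
  have : Fintype F := Fintype.ofFinite F
  obtain ⟨κ, hκ, hsep⟩ := exists_separated z
  obtain ⟨δ, hδ0, hδ⟩ := exists_forall_le_norm_sub z
  have hr : 0 < min κ δ := lt_min hκ hδ0
  refine exists_hasExpansion_of_approx hr
    (fun ε hε => add_notMem_range hδ (hε.trans_le (min_le_right _ _))) fun τ hτ => ?_
  have hτ' : 0 < τ / (‖π⁻¹‖ + 1) := by positivity
  -- Only finitely many blocks can exceed the tolerance anywhere on the ball; the rest have a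
  -- uniformly small sum by the ultrametric inequality.
  set s := (finite_lt_inv_max (F := F) (B := (κ ^ 2)⁻¹) hτ').toFinset with hs
  have hterm : ∀ a b : A F, ∃ c, SumsOnBall (min κ δ) c (fun ε => eisTerm a b ((z : CInf F) + ε)) := by
    intro a b
    rcases eq_or_ne a 0 with rfl | ha
    · exact ⟨_, by simpa [eisTerm] using SumsOnBall.const (r := min κ δ) (0 : CInf F)⟩
    · have ha' := ofA_ne_zero ha
      have hα : min κ δ ≤ ‖-((ofA a * (z : CInf F) + ofA b) / ofA a)‖ := by
        rw [norm_neg, norm_div, le_div_iff₀ (norm_pos_iff.2 ha')]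
        refine le_trans ?_ (hsep a b)
        exact mul_le_mul (min_le_left _ _) (le_max_left _ _) (norm_nonneg _) hκ.le
      refine ⟨_, (SumsOnBall.inv_sub hr hα).congr fun ε hε => ?_⟩
      have hne := (hsep.add_small (hε.trans_le (min_le_left _ _))).add_ne_zero hκ (b := b)
        (Or.inl ha)
      rw [eisTerm]
      have : ε - -((ofA a * (z : CInf F) + ofA b) / ofA a) =
          (ofA a * ((z : CInf F) + ε) + ofA b) / ofA a := by
        field_simp
        ring
      rw [this, inv_div]
  obtain ⟨c, hc⟩ := SumsOnBall.sum hr s (f := fun p ε => eisBlock p ((z : CInf F) + ε)) fun p _ => by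
    simp only [eisBlock_eq_sum]
    exact SumsOnBall.sum hr _ fun e _ => hterm _ _
  refine ⟨_, _, hc.const_smul (-π⁻¹), fun ε hε => ?_⟩
  have hsepε := hsep.add_small (hε.trans_le (min_le_left κ δ))
  rw [falseE_eq]
  simp only [Pi.smul_apply, smul_eq_mul]
  have hsum := (hsepε.summable_eisBlock hκ)
  rw [← mul_sub, ← hsum.sum_add_tsum_compl (s := s), add_sub_cancel_left, norm_mul, norm_neg]
  have htail : ‖∑' p : ((s : Set (A F × A F))ᶜ : Set (A F × A F)),
      eisBlock p.1 ((z : CInf F) + ε)‖ ≤ τ / (‖π⁻¹‖ + 1) := by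
    refine IsUltrametricDist.norm_tsum_le_of_forall_le_of_nonneg hτ'.le fun p => ?_
    refine (hsepε.norm_eisBlock_le hκ p.1).trans (not_lt.1 fun hlt => p.2 ?_)
    exact Finset.mem_coe.2 ((Set.Finite.mem_toFinset _).2 hlt)
  calc ‖π⁻¹‖ * _ ≤ (‖π⁻¹‖ + 1) * (τ / (‖π⁻¹‖ + 1)) := by
        gcongr
        linarith
    _ = τ := by field_simp

/-! ### Transformation of the false Eisenstein series under z ↦ z/(cz+1). -/

variable (F) in
/-- The polynomials of degree less than `n`. -/
def polyLT : ℕ → Finset (A F)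
  | 0 => {0}
  | n + 1 => ((polyLT n) ×ˢ (Set.toFinite (Set.univ : Set F)).toFinset).map
      (divXEquiv F).symm.toEmbedding

theorem mem_polyLT {n : ℕ} {a : A F} : a ∈ polyLT F n ↔ ∀ i, n ≤ i → a.coeff i = 0 := by
  induction n generalizing a with
  | zero => simp [polyLT, Polynomial.ext_iff]
  | succ n ih =>
    rw [polyLT, Finset.mem_map_equiv, Equiv.symm_symm, Finset.mem_product, ih]
    simp only [Set.Finite.mem_toFinset, Set.mem_univ, and_true]
    change (∀ i, n ≤ i → a.divX.coeff i = 0) ↔ _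
    simp only [coeff_divX]
    refine ⟨fun h i hi => ?_, fun h i hi => h _ (by omega)⟩
    obtain ⟨j, rfl⟩ : ∃ j, i = j + 1 := ⟨i - 1, by omega⟩
    exact h j (by omega)

theorem card_polyLT (n : ℕ) : (polyLT F n).card = Nat.card F ^ n := by
  induction n with
  | zero => simp [polyLT]
  | succ n ih =>
    rw [polyLT, Finset.card_map, Finset.card_product, ih, ← Set.ncard_eq_toFinset_card,
      Set.ncard_univ, pow_succ]

theorem sum_polyLT_succ [Fintype F] (n : ℕ) (f : A F → CInf F) :
    ∑ b ∈ polyLT F (n + 1), f b = ∑ b ∈ polyLT F n, ∑ e : F, f (X * b + C e) := by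
  rw [polyLT, Finset.sum_map, Finset.sum_product]
  refine Finset.sum_congr rfl fun b _ => ?_
  rw [Set.Finite.toFinset_univ]
  rfl

theorem sum_eisBlock_polyLT (m n : ℕ) (w : CInf F) :
    ∑ p ∈ polyLT F m ×ˢ polyLT F n, eisBlock p w =
      ∑ p ∈ polyLT F m ×ˢ polyLT F (n + 1), eisTerm p.1 p.2 w := by
  have : Fintype F := Fintype.ofFinite F
  rw [Finset.sum_product, Finset.sum_product]
  refine Finset.sum_congr rfl fun a _ => ?_
  rw [sum_polyLT_succ]
  exact Finset.sum_congr rfl fun b _ => eisBlock_eq_sum _ _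

/-- The window for a is wider by d, to be taken as deg c + 1, so that it absorbs the shear a ↦ a +
cb. -/
theorem tendsto_polyLT_prod (d : ℕ) :
    Tendsto (fun n => polyLT F (n + d) ×ˢ polyLT F n) atTop atTop := by
  refine tendsto_atTop_finset_of_monotone (fun m n hmn => ?_) fun p => ?_
  · refine Finset.product_subset_product (fun a ha => ?_) (fun a ha => ?_)
    · exact mem_polyLT.2 fun i hi => mem_polyLT.1 ha i (by omega)
    · exact mem_polyLT.2 fun i hi => mem_polyLT.1 ha i (by omega)
  · refine ⟨p.1.natDegree + p.2.natDegree + 1, Finset.mem_product.2 ⟨?_, ?_⟩⟩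
    · exact mem_polyLT.2 fun i hi => coeff_eq_zero_of_natDegree_lt (by omega)
    · exact mem_polyLT.2 fun i hi => coeff_eq_zero_of_natDegree_lt (by omega)

theorem sum_eisTerm_transform {κ₁ κ : ℝ} {w₁ w : CInf F} (hκ₁ : 0 < κ₁) (h₁ : Separated κ₁ w₁)
    (hκ : 0 < κ) (h : Separated κ w) (c : A F) (hw : w₁ * (ofA c * w + 1) = w) (n : ℕ) :
    ∑ p ∈ polyLT F (n + (c.natDegree + 1)) ×ˢ polyLT F (n + 1), eisTerm p.1 p.2 w₁ =
      (ofA c * w + 1) ^ 2 *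
        ∑ p ∈ polyLT F (n + (c.natDegree + 1)) ×ˢ polyLT F (n + 1), eisTerm p.1 p.2 w +
      ofA c * (ofA c * w + 1) := by
  classical
  set J := ofA c * w + 1 with hJ
  set W := polyLT F (n + (c.natDegree + 1)) ×ˢ polyLT F (n + 1) with hW
  have hmul : ∀ b ∈ polyLT F (n + 1), ∀ i, n + (c.natDegree + 1) ≤ i → (c * b).coeff i = 0 := by
    intro b hb i hi
    have hdeg : b.natDegree ≤ n :=
      natDegree_le_iff_coeff_eq_zero.2 fun j hj => mem_polyLT.1 hb j (by omega)
    exact coeff_eq_zero_of_natDegree_lt (natDegree_mul_le.trans_lt (by omega))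
  have hreindex : ∑ p ∈ W, eisTerm p.1 p.2 w₁ = ∑ p ∈ W, eisTerm (p.1 - c * p.2) p.2 w₁ := by
    refine Finset.sum_bij' (fun p _ => (p.1 + c * p.2, p.2)) (fun p _ => (p.1 - c * p.2, p.2))
      (fun p hp => ?_) (fun p hp => ?_) (fun p _ => by simp) (fun p _ => by simp)
      (fun p _ => by simp)
    · obtain ⟨ha, hb⟩ := Finset.mem_product.1 hp
      refine Finset.mem_product.2 ⟨mem_polyLT.2 fun i hi => ?_, hb⟩
      rw [coeff_add, mem_polyLT.1 ha i hi, hmul _ hb i hi, add_zero]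
    · obtain ⟨ha, hb⟩ := Finset.mem_product.1 hp
      refine Finset.mem_product.2 ⟨mem_polyLT.2 fun i hi => ?_, hb⟩
      rw [coeff_sub, mem_polyLT.1 ha i hi, hmul _ hb i hi, sub_zero]
  -- Since J(a - cb) = J²a - cJ(aw+b), each nonzero pair contributes the same defect -cJ. At p = 0
  -- both terms are 0/0 = 0, so there is no defect and the correction term is needed.
  have hterm : ∀ p ∈ W, eisTerm (p.1 - c * p.2) p.2 w₁ =
      J ^ 2 * eisTerm p.1 p.2 w - (ofA c * J - if p = 0 then ofA c * J else 0) := by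
    rintro ⟨a, b⟩ -
    by_cases h0 : (a, b) = 0
    · obtain ⟨rfl, rfl⟩ := Prod.mk_eq_zero.1 h0
      simp [eisTerm]
    · have hab : a ≠ 0 ∨ b ≠ 0 := by
        by_contra! h2
        exact h0 (Prod.mk_eq_zero.2 h2)
      have hne := h.add_ne_zero hκ hab
      have hab₁ : a - c * b ≠ 0 ∨ b ≠ 0 := by
        by_contra! h2
        obtain ⟨h2, rfl⟩ := h2
        simp at h2
        simp [h2] at hab
      have hne₁ := h₁.add_ne_zero hκ₁ hab₁
      rw [if_neg h0, sub_zero, eisTerm, eisTerm]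
      simp only
      have hden : (ofA (a - c * b) * w₁ + ofA b) * J = ofA a * w + ofA b := by
        rw [map_sub, map_mul, add_mul, mul_assoc, hw, hJ]
        ring
      have hJ0 : J ≠ 0 := right_ne_zero_of_mul (hden ▸ hne)
      rw [← mul_div_mul_right _ _ hJ0, hden, div_eq_iff hne, sub_mul, mul_assoc (J ^ 2),
        div_mul_cancel₀ _ hne, map_sub, map_mul, hJ]
      ring
  have h0W : (0 : A F × A F) ∈ W :=
    Finset.mem_product.2 ⟨mem_polyLT.2 fun i _ => by simp, mem_polyLT.2 fun i _ => by simp⟩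
  -- The size of the window is a positive power of q, so the constant defects cancel and only the
  -- correction at p = 0 survives.
  have hcard : (W.card : CInf F) = 0 := by
    rw [hW, Finset.card_product, card_polyLT, card_polyLT]
    simp [card_eq_zero]
  rw [hreindex, Finset.sum_congr rfl hterm, Finset.sum_sub_distrib, ← Finset.mul_sum,
    Finset.sum_sub_distrib, Finset.sum_const, nsmul_eq_mul, hcard, Finset.sum_ite_eq', if_pos h0W]
  ring

theorem falseE_transform (π : CInf F) (c : A F) (z z₁ : Omega F)
    (hz : (z₁ : CInf F) * (ofA c * z + 1) = z) :
    falseE π z₁ = (ofA c * z + 1) ^ 2 * falseE π z + -π⁻¹ * ofA c * (ofA c * z + 1) := by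
  obtain ⟨κ, hκ, h⟩ := exists_separated z
  obtain ⟨κ₁, hκ₁, h₁⟩ := exists_separated z₁
  have ht := tendsto_polyLT_prod (F := F) (c.natDegree + 1)
  have hl := (h₁.summable_eisBlock hκ₁).hasSum.comp ht
  have hr := (((h.summable_eisBlock hκ).hasSum.comp ht).const_mul ((ofA c * (z : CInf F) + 1) ^ 2)).add_const
    (ofA c * (ofA c * (z : CInf F) + 1))
  have heq := tendsto_nhds_unique hl (hr.congr fun n => by
    simp only [Function.comp_apply]
    rw [sum_eisBlock_polyLT, sum_eisBlock_polyLT,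
      sum_eisTerm_transform hκ₁ h₁ hκ h c hz])
  rw [falseE_eq, falseE_eq, heq]
  ring

end FalseEisenstein

/-! ### Uniqueness of associated polynomials and the slash action on hyperderivatives. -/

section AssociatedPolynomial

variable {F : Type*} [Field F]

/-- The matrix `(1 0; c 1)` over `A`. -/
def lowerUnipotentA (c : A F) : GL (Fin 2) (A F) where
  val := !![1, 0; c, 1]
  inv := !![1, 0; -c, 1]
  val_inv := by ext i j; fin_cases i <;> fin_cases j <;> simp [Matrix.mul_apply]
  inv_val := by ext i j; fin_cases i <;> fin_cases j <;> simp [Matrix.mul_apply]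

/-- The matrix `(1 0; c 1)` over `K`, for `c ∈ A`. -/
def lowerUnipotent (c : A F) : GL (Fin 2) (K F) :=
  Matrix.GeneralLinearGroup.map (algebraMap (A F) (K F)) (lowerUnipotentA c)

theorem lowerUnipotent_mem_principal {𝔪 : Ideal (A F)} {c : A F} (hc : c ∈ 𝔪) :
    lowerUnipotent c ∈ principal 𝔪 := by
  refine Subgroup.mem_map_of_mem _ ?_
  rw [MonoidHom.mem_ker]
  ext i j
  have hc' : Ideal.Quotient.mk 𝔪 c = 0 := Ideal.Quotient.eq_zero_iff_mem.2 hc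
  fin_cases i <;> fin_cases j <;> simp [lowerUnipotentA, hc']

variable [Finite F]

theorem ofK_lowerUnipotent_one_zero (c : A F) : ofK (lowerUnipotent c 1 0) = ofA c := by
  simp [lowerUnipotent, lowerUnipotentA, ofA]

theorem den_lowerUnipotent (c : A F) (z : Omega F) :
    den (lowerUnipotent c) z = ofA c * z + 1 := by
  rw [den, ofK_lowerUnipotent_one_zero]
  simp [lowerUnipotent, lowerUnipotentA]

theorem moebius_lowerUnipotent (c : A F) (z : Omega F) :
    (moebius (lowerUnipotent c) z : CInf F) * (ofA c * z + 1) = z := by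
  have h := den_ne_zero (lowerUnipotent c) z
  change num (lowerUnipotent c) z / den (lowerUnipotent c) z * _ = _
  rw [← den_lowerUnipotent, div_mul_cancel₀ _ h]
  simp [num, lowerUnipotent, lowerUnipotentA]

theorem ofA_mul_add_one_ne_zero (c : A F) (z : Omega F) : ofA c * (z : CInf F) + 1 ≠ 0 :=
  den_lowerUnipotent c z ▸ den_ne_zero (lowerUnipotent c) z

theorem slash_lowerUnipotent (k : ℕ) (m : ℤ) (f : Omega F → CInf F) (c : A F) (z : Omega F) :
    slash k m f (lowerUnipotent c) z =
      ((ofA c * z + 1) ^ k)⁻¹ * f (moebius (lowerUnipotent c) z) := by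
  have hdet : ((lowerUnipotent c).det : K F) = 1 := by
    rw [Matrix.GeneralLinearGroup.val_det_apply, Matrix.det_fin_two]
    simp [lowerUnipotent, lowerUnipotentA]
  rw [slash, hdet, map_one, one_zpow, one_mul, den_lowerUnipotent, zpow_neg, zpow_natCast]

theorem IsAssocPoly.eval₂ {Γ : Subgroup (GL (Fin 2) (K F))} {k m : ℤ} {f : Omega F → CInf F}
    {P : (Omega F → CInf F)[X]} (hP : IsAssocPoly Γ k m f P) {c : A F}
    (hc : lowerUnipotent c ∈ Γ) (z : Omega F) :
    slash k m f (lowerUnipotent c) z =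
      P.eval₂ (Pi.evalRingHom _ z) (ofA c / (ofA c * z + 1)) := by
  rw [hP.2 _ hc, eval₂_eq_sum_range, ofK_lowerUnipotent_one_zero, den_lowerUnipotent]
  rfl

/-- A polynomial with coefficients functions on `Ω` is determined by its values at
`c / (cz + 1)` for `c` in a nonzero ideal. -/
theorem eq_of_eval₂_eq {𝔪 : Ideal (A F)} (h𝔪 : 𝔪 ≠ ⊥) {P Q : (Omega F → CInf F)[X]}
    (h : ∀ c ∈ 𝔪, ∀ z : Omega F,
      P.eval₂ (Pi.evalRingHom _ z) (ofA c / (ofA c * z + 1)) =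
        Q.eval₂ (Pi.evalRingHom _ z) (ofA c / (ofA c * z + 1))) : P = Q := by
  obtain ⟨μ, hμ, hμ0⟩ := Submodule.exists_mem_ne_zero_of_ne_bot h𝔪
  have key : ∀ z : Omega F, P.map (Pi.evalRingHom _ z) = Q.map (Pi.evalRingHom _ z) := by
    intro z
    -- At fixed z, cross-multiplication shows that c ↦ c/(cz+1) is injective, so the multiples of μ
    -- give infinitely many points of agreement.
    refine Polynomial.eq_of_infinite_eval_eq _ _ (Set.infinite_of_injective_forall_mem
      (f := fun a : A F => ofA (a * μ) / (ofA (a * μ) * (z : CInf F) + 1)) (fun a b hab => ?_)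
      fun a => ?_)
    · rw [div_eq_div_iff (ofA_mul_add_one_ne_zero _ z) (ofA_mul_add_one_ne_zero _ z)] at hab
      have : ofA (a * μ) = ofA (b * μ) := by linear_combination hab
      exact mul_right_cancel₀ hμ0 (ofA_injective this)
    · change eval _ _ = eval _ _
      rw [eval_map, eval_map]
      exact h _ (𝔪.mul_mem_left a hμ) z
  ext i z
  have := congrArg (fun p => p.coeff i) (key z)
  simpa only [coeff_map, Pi.evalRingHom_apply] using this

/-- An identity on the lower unipotent matrices suffices: the polynomial supplied by
quasi-modularity must equal Q, so Q inherits membership in 𝒪 and the identity for all of Γ. -/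
theorem isAssocPoly_iff_eq {Γ : Subgroup (GL (Fin 2) (K F))} (hΓ : IsCongruence Γ) {k m : ℤ}
    {ℓ : ℕ} {f : Omega F → CInf F} (hf : IsQuasiModularForm Γ k m ℓ f)
    {Q : (Omega F → CInf F)[X]}
    (hQ : ∀ c, lowerUnipotent c ∈ Γ → ∀ z : Omega F, slash k m f (lowerUnipotent c) z =
      Q.eval₂ (Pi.evalRingHom _ z) (ofA c / (ofA c * z + 1))) (P : (Omega F → CInf F)[X]) :
    IsAssocPoly Γ k m f P ↔ P = Q := by
  obtain ⟨-, 𝔪, h𝔪, hle⟩ := hΓ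
  have key : ∀ P, IsAssocPoly Γ k m f P → P = Q := fun P hP =>
    eq_of_eval₂_eq h𝔪 fun c hc z => by
      have hmem := hle (lowerUnipotent_mem_principal hc)
      rw [← hP.eval₂ hmem, hQ c hmem]
  refine ⟨key P, ?_⟩
  rintro rfl
  obtain ⟨-, P₀, -, hP₀, -⟩ := hf
  exact key P₀ hP₀ ▸ hP₀

/-- Depth 0 only says that slashing by any γ gives one fixed function; γ = 1 identifies it with g.
-/
theorem IsModularForm.slash_eq {Γ : Subgroup (GL (Fin 2) (K F))} {k m : ℤ}
    {g : Omega F → CInf F} (hg : IsModularForm Γ k m g) {γ : GL (Fin 2) (K F)} (hγ : γ ∈ Γ)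
    (z : Omega F) : slash k m g γ z = g z := by
  obtain ⟨-, P, hdeg, hP, -⟩ := hg
  have h0 : ∀ γ ∈ Γ, slash k m g γ z = P.coeff 0 z := fun γ hγ => by
    rw [hP.2 γ hγ, Nat.le_zero.1 hdeg]
    simp
  have hone : slash k m g 1 z = g z := by
    have hm : moebius (1 : GL (Fin 2) (K F)) z = z := by
      ext
      simp [moebius, num, den]
    simp [slash, hm, den]
  rw [h0 γ hγ, ← h0 1 Γ.one_mem, hone]

theorem IsModularForm.transform {Γ : Subgroup (GL (Fin 2) (K F))} {N : ℕ} {k m : ℤ}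
    (hN : (N : ℤ) = k) {g : Omega F → CInf F} (hg : IsModularForm Γ k m g) {c : A F}
    (hc : lowerUnipotent c ∈ Γ) (w w₁ : Omega F) (hw : (w₁ : CInf F) * (ofA c * w + 1) = w) :
    g w₁ = (ofA c * w + 1) ^ N * g w := by
  subst hN
  have hJ := ofA_mul_add_one_ne_zero c w
  have hmw : moebius (lowerUnipotent c) w = w₁ :=
    Subtype.ext (mul_right_cancel₀ hJ ((moebius_lowerUnipotent c w).trans hw.symm))
  have h := hg.slash_eq hc w
  rw [slash_lowerUnipotent, hmw] at h
  rw [← h, mul_inv_cancel_left₀ (pow_ne_zero _ hJ)]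

theorem normDeriv_apply (π : CInf F) (n : ℕ) (f : Omega F → CInf F) (z : Omega F) :
    normDeriv π n f z = ((-π) ^ n)⁻¹ * hyperDeriv n f z := rfl

/-- The transformation of the normalised hyperderivatives of a modular form under
`(1 0; c 1)`. -/
theorem IsModularForm.normDeriv_moebius {π : CInf F} {Γ : Subgroup (GL (Fin 2) (K F))}
    {N : ℕ} (hN1 : 1 ≤ N) {k m : ℤ} (hN : (N : ℤ) = k) {g : Omega F → CInf F}
    (hg : IsModularForm Γ k m g) {c : A F} (hc : lowerUnipotent c ∈ Γ) (h : ℕ) (z : Omega F) :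
    normDeriv π h g (moebius (lowerUnipotent c) z) = (ofA c * z + 1) ^ (N + 2 * h) *
      ∑ j ∈ Finset.range (h + 1), ((-π) ^ j)⁻¹ *
        ((Nat.choose (N + h - 1) j : CInf F) * normDeriv π (h - j) g z) *
          (ofA c / (ofA c * z + 1)) ^ j := by
  have hexp := hasExpansion_hyperDeriv (hg.1.exists_hasExpansion z)
  have htrans := hexp.of_transformation (ofA c) 0 hN1 (ofA_mul_add_one_ne_zero c z)
    (moebius_lowerUnipotent c z) fun w w₁ hw => by
      rw [hg.transform hN hc w w₁ hw, zero_mul, zero_mul, add_zero]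
  rw [normDeriv_apply, hyperDeriv_eq htrans, zero_mul, add_zero, mul_left_comm, Finset.mul_sum]
  congr 1
  refine Finset.sum_congr rfl fun j hj => ?_
  have hj : j ≤ h := by simpa [Nat.lt_succ_iff] using hj
  rw [normDeriv_apply]
  nth_rewrite 1 [← Nat.add_sub_cancel' hj]
  rw [pow_add, mul_inv]
  ring

/-- The transformation of the normalised hyperderivatives of the false Eisenstein series under
`(1 0; c 1)`. -/
theorem normDeriv_falseE_moebius {π : CInf F} (c : A F) (h : ℕ) (z : Omega F) :
    normDeriv π h (falseE π) (moebius (lowerUnipotent c) z) = (ofA c * z + 1) ^ (2 + 2 * h) *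
      (((-π) ^ (h + 1))⁻¹ * (ofA c / (ofA c * z + 1)) ^ (h + 1) +
        ∑ j ∈ Finset.range (h + 1), ((-π) ^ j)⁻¹ *
          ((Nat.choose (h + 1) j : CInf F) * normDeriv π (h - j) (falseE π) z) *
            (ofA c / (ofA c * z + 1)) ^ j) := by
  have hJ := ofA_mul_add_one_ne_zero c z
  have hexp := hasExpansion_hyperDeriv (falseE_exists_hasExpansion π z)
  have htrans := hexp.of_transformation (ofA c) (-π⁻¹) one_le_two hJ
    (moebius_lowerUnipotent c z) fun w w₁ hw => falseE_transform π c w w₁ hw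
  rw [normDeriv_apply, hyperDeriv_eq htrans]
  generalize ofA c * (z : CInf F) + 1 = J at hJ ⊢
  rw [mul_add, add_comm, mul_add]
  congr 1
  · have h1 : J ^ (2 + 2 * h) = (J ^ (h + 1)) ^ 2 := by
      rw [← pow_mul]
      congr 1
      omega
    rw [h1, pow_succ (-π), mul_inv, ← inv_neg, div_pow, mul_pow]
    field_simp
  · rw [mul_left_comm, Finset.mul_sum]
    congr 1
    refine Finset.sum_congr rfl fun j hj => ?_
    have hj : j ≤ h := by simpa [Nat.lt_succ_iff] using hj
    have hch : 2 + h - 1 = h + 1 := by omega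
    rw [normDeriv_apply, hch]
    nth_rewrite 1 [← Nat.add_sub_cancel' hj]
    rw [pow_add, mul_inv]
    ring

theorem sum_range_sum_range_succ_eq {M : Type*} [AddCommMonoid M] (n : ℕ) (f : ℕ → ℕ → M) :
    ∑ h ∈ Finset.range (n + 1), ∑ j ∈ Finset.range (h + 1), f h j =
      ∑ j ∈ Finset.range (n + 1), ∑ h ∈ Finset.Icc j n, f h j :=
  Finset.sum_comm' fun h j => by
    simp only [Finset.mem_range, Finset.mem_Icc]
    omega

/-- The slash operator on a sum of normalised hyperderivatives of modular forms. -/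
theorem slash_sum_normDeriv {π : CInf F} {Γ : Subgroup (GL (Fin 2) (K F))} {k n : ℕ}
    (hk : 2 * n < k) {m : ℤ} {fD : ℕ → Omega F → CInf F}
    (hfD : ∀ i ≤ n, IsModularForm Γ (k - 2 * i) (m - i) (fD i)) {c : A F}
    (hc : lowerUnipotent c ∈ Γ) (z : Omega F) :
    ((ofA c * (z : CInf F) + 1) ^ k)⁻¹ *
        ∑ i ∈ Finset.range (n + 1), normDeriv π i (fD i) (moebius (lowerUnipotent c) z) =
      ∑ j ∈ Finset.range (n + 1), ((-π) ^ j)⁻¹ * (∑ h ∈ Finset.Icc j n,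
        (Nat.choose (k - h - 1) j : CInf F) * normDeriv π (h - j) (fD h) z) *
          (ofA c / (ofA c * z + 1)) ^ j := by
  have hJ := pow_ne_zero k (ofA_mul_add_one_ne_zero c z)
  simp only [Finset.mul_sum, Finset.sum_mul]
  rw [← sum_range_sum_range_succ_eq]
  refine Finset.sum_congr rfl fun h hh => ?_
  have hh : h ≤ n := by simpa [Nat.lt_succ_iff] using hh
  -- For weight N = k - 2h the automorphy factor J^(N+2h) is J^k for every h and cancels, and the
  -- upper binomial index N + h - 1 becomes k - h - 1. The bound 2n < k keeps N ≥ 1.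
  have h1 : k - 2 * h + 2 * h = k := by omega
  have h2 : k - 2 * h + h - 1 = k - h - 1 := by omega
  rw [(hfD h hh).normDeriv_moebius (N := k - 2 * h) (by omega)
    (by rw [Nat.cast_sub (by omega)]; push_cast; rfl) hc, h1, h2, inv_mul_cancel_left₀ hJ]

end AssociatedPolynomial

end Drinfeld

end

/-! ### The two cases of the theorem. -/

theorem theorem4p8 {F : Type*} [Field F] [Finite F]
    (π : Drinfeld.CInf F) (hπ : Drinfeld.IsCarlitzPeriod π)
    (Γ : Subgroup (GL (Fin 2) (Drinfeld.K F))) (hΓ : Drinfeld.IsCongruence Γ)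
    (k ℓ : ℕ) (m : ℤ) (hℓ : 1 ≤ ℓ)
    (f : Drinfeld.Omega F → Drinfeld.CInf F)
    (hf : Drinfeld.IsQuasiModularForm Γ k m ℓ f)
    (fD : ℕ → Drinfeld.Omega F → Drinfeld.CInf F) :
    (2 * ℓ < k →
      (∀ i ≤ ℓ, Drinfeld.IsModularForm Γ (k - 2 * i) (m - i) (fD i)) →
      f = ∑ i ∈ Finset.range (ℓ + 1), Drinfeld.normDeriv π i (fD i) →
      ∀ P : (Drinfeld.Omega F → Drinfeld.CInf F)[X],
        Drinfeld.IsAssocPoly Γ k m f P ↔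
          P = ∑ j ∈ Finset.range (ℓ + 1), monomial j
            (((-π) ^ j)⁻¹ • ∑ h ∈ Finset.Icc j ℓ,
              (Nat.choose (k - h - 1) j : Drinfeld.CInf F) •
                Drinfeld.normDeriv π (h - j) (fD h))) ∧
    (k = 2 * ℓ → ∀ α : Drinfeld.CInf F,
      (∀ i < ℓ, Drinfeld.IsModularForm Γ (k - 2 * i) (m - i) (fD i)) →
      f = α • Drinfeld.normDeriv π (ℓ - 1) (Drinfeld.falseE π) +
        ∑ i ∈ Finset.range ℓ, Drinfeld.normDeriv π i (fD i) →
      ∀ P : (Drinfeld.Omega F → Drinfeld.CInf F)[X],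
        Drinfeld.IsAssocPoly Γ k m f P ↔
          P = monomial ℓ (fun _ => α * ((-π) ^ ℓ)⁻¹) +
            ∑ j ∈ Finset.range ℓ, monomial j
              (((-π) ^ j)⁻¹ •
                ((α * (Nat.choose ℓ j : Drinfeld.CInf F)) •
                    Drinfeld.normDeriv π (ℓ - j - 1) (Drinfeld.falseE π) +
                  ∑ h ∈ Finset.Icc j (ℓ - 1),
                    (Nat.choose (2 * ℓ - h - 1) j : Drinfeld.CInf F) •
                      Drinfeld.normDeriv π (h - j) (fD h)))) := by
  constructor
  · intro hk hfD hsum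
    refine Drinfeld.isAssocPoly_iff_eq hΓ hf fun c hc z => ?_
    rw [Drinfeld.slash_lowerUnipotent, hsum, Finset.sum_apply,
      Drinfeld.slash_sum_normDeriv hk hfD hc, eval₂_finsetSum]
    refine Finset.sum_congr rfl fun j _ => ?_
    simp only [eval₂_monomial, Pi.evalRingHom_apply, Pi.smul_apply, Finset.sum_apply, smul_eq_mul]
  · rintro rfl α hfD hsum
    -- With ℓ = n + 1, the form D_n E transforms with factor J^(2+2n) = J^k; its binomials C(n+1, j)
    -- are C(ℓ, j), and its extra term is the coefficient of X^ℓ.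
    obtain ⟨n, rfl⟩ : ∃ n, ℓ = n + 1 := ⟨ℓ - 1, by omega⟩
    refine Drinfeld.isAssocPoly_iff_eq hΓ hf fun c hc z => ?_
    have hJ := pow_ne_zero (2 * (n + 1)) (Drinfeld.ofA_mul_add_one_ne_zero c z)
    have h1 : 2 + 2 * n = 2 * (n + 1) := by omega
    rw [Drinfeld.slash_lowerUnipotent, hsum, Pi.add_apply, Finset.sum_apply, mul_add,
      Drinfeld.slash_sum_normDeriv (by omega) (fun i hi => hfD i (Nat.lt_succ_of_le hi)) hc,
      Pi.smul_apply, Nat.add_sub_cancel, Drinfeld.normDeriv_falseE_moebius, h1, smul_eq_mul,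
      mul_left_comm, inv_mul_cancel_left₀ hJ, mul_add, add_assoc, Finset.mul_sum,
      ← Finset.sum_add_distrib, eval₂_add, eval₂_finsetSum]
    congr 1
    · simp [eval₂_monomial, mul_assoc]
    · refine Finset.sum_congr rfl fun j _ => ?_
      have h2 : n + 1 - j - 1 = n - j := by omega
      simp only [eval₂_monomial, Pi.evalRingHom_apply, Pi.smul_apply, Pi.add_apply,
        Finset.sum_apply, smul_eq_mul, h2]
      ring
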